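/- Let $G$ be a countable group and let $\Sigma=(\sigma_n:G\to\mathrm{Sym}(V_n))_{n\ge1}$ be a sofic approximation to $G$: the $V_n$ are non-empty finite sets, $|\{v\in V_n:\sigma_n^g(\sigma_n^h(v))=\sigma_n^{gh}(v)\}|/|V_n|\to1$ for all $g,h\in G$, and $|\{v\in V_n:\sigma_n^g(v)\ne v\}|/|V_n|\to1$ for all $g\in G\setminus\{e\}$. Let $(W_n)_{n\ge1}$ be non-empty finite sets with $|W_n|\to\infty$, and let $\tilde\Sigma=(\tilde\sigma_n)_{n\ge1}$ be the sofic approximation $$\tilde\sigma_n^g:=\sigma_n^g\times\mathrm{Id}_{W_n}\in\mathrm{Sym}(V_n\times W_n).$$ Let $(\mathcal X,d)$ be a compact metric space with its Borel $\sigma$-algebra and let $\mu$ be a Borel probability measure on $\mathcal X^G$. (The case of interest is a metric $G$-process, for which $\mu$ is shift-invariant; the statement does not need this assumption.) Let $\mathfrak P$ be a family of finite Borel partitions of $\mathcal X$ such that - for every $\delta>0$ some $\mathcal P\in\mathfrak P$ has all its cells of diameter less than $\delta$; - $\mu\{x\in\mathcal X^G:x_e\in\partial C\}=0$ for every cell $C$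 of every $\mathcal P\in\mathfrak P$. Then $$\mathrm h^{\mathrm m}_{\tilde\Sigma}(\mu)=\tilde{\mathrm h}_\Sigma(\mu):=\sup\Big\{\limsup_{i\to\infty}\frac1{|V_{n_i}|}\mathrm H_{\mu_i}(\mathcal P^{V_{n_i}}):\ \mathcal P\in\mathfrak P,\ n_i\uparrow\infty,\ \mu_i\in\Pr(\mathcal X^{V_{n_i}}),\ \mu_i\stackrel{\mathrm{lw}\ast}{\to}\mu\text{ over }(\sigma_{n_i})_{i\ge1}\Big\}$$ as elements of $[-\infty,\infty]$, with $\sup\emptyset=-\infty$. The notation is as follows. * $\mathrm H_\nu$ is Shannon entropy with natural logarithms, and $\mathcal P^V$ is the partition of $\mathcal X^V$ into products of cells of $\mathcal P$. * For $\sigma:G\to\mathrm{Sym}(V)$ with $V$ finite, $v\in V$ and $\mathbf x\in\mathcal X^V$, put $\Pi^\sigma_v(\mathbf x)=(x_{\sigma^g(v)})_{g\in G}$ and $P^\sigma_{\mathbf x}=\frac1{|V|}\sum_{v\in V}\delta_{\Pi^\sigma_v(\mathbf x)}\in\Pr(\mathcal X^G)$. * For maps $\sigma_i:G\to\mathrm{Sym}(V_i)$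 and $\mu_i\in\Pr(\mathcal X^{V_i})$, $\mu_i\stackrel{\mathrm{lw}\ast}{\to}\mu$ over $(\sigma_i)$ means that $|\{v\in V_i:(\Pi^{\sigma_i}_v)_*\mu_i\in U\}|/|V_i|\to1$ for every weak$^*$ neighbourhood $U$ of $\mu$. Moreover $\mu_i\stackrel{\mathrm{le}}{\to}\mu$ means that in addition $\mu_i\{\mathbf x:P^{\sigma_i}_{\mathbf x}\in U\}\to1$ for every such $U$, and $\mu_i\stackrel{\mathrm{lde}}{\to}\mu$ means that $\mu_i\times\mu_i\stackrel{\mathrm{le}}{\to}\mu\times\mu$, where $\mathcal X^{V_i}\times\mathcal X^{V_i}=(\mathcal X\times\mathcal X)^{V_i}$ and $\mathcal X^G\times\mathcal X^G=(\mathcal X\times\mathcal X)^G$. * The model-measure sofic entropy of $\mu$ rel a sofic approximation $\Sigma=(\sigma_n:G\to\mathrm{Sym}(V_n))_{n\ge1}$ is $$\mathrm h^{\mathrm m}_{\Sigma}(\mu)=\sup\Big\{\sup_{\varepsilon,\delta>0}\limsup_{i\to\infty}\frac1{|V_{n_i}|}\log\mathrm{cov}_{\varepsilon,\delta}(\mu_i,d^{(V_{n_i})}):\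 n_i\uparrow\infty,\ \mu_i\in\Pr(\mathcal X^{V_{n_i}}),\ \mu_i\stackrel{\mathrm{lde}}{\to}\mu\text{ over }(\sigma_{n_i})_{i\ge1}\Big\},$$ where $\mathrm{cov}_{\varepsilon,\delta}(\nu,d^{(V)})$ is the least number of $\delta$-balls in the metric $d^{(V)}(\mathbf x,\mathbf y)=\frac1{|V|}\sum_{v\in V}d(x_v,y_v)$ needed to cover more than $1-\varepsilon$ of the measure $\nu$. -/

import Mathlib

open MeasureTheory Filter Topology

noncomputable section

namespace SoficEntropy

universe u v w z

/-! ### Sofic approximations -/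

/-- A sequence of maps `σ n : G → Sym (V n)` into the symmetric groups of finite sets is a sofic
approximation to `G` if it is asymptotically multiplicative and asymptotically free. -/
structure IsSoficApproximation {G : Type u} [Group G] {V : ℕ → Type v} [∀ n, Fintype (V n)]
    (σ : ∀ n, G → Equiv.Perm (V n)) : Prop where
  mul : ∀ g h : G, Tendsto
    (fun n => ({p : V n | σ n g (σ n h p) = σ n (g * h) p}.ncard : ℝ) / Fintype.card (V n))
    atTop (𝓝 1)
  free : ∀ g : G, g ≠ 1 → Tendsto
    (fun n => ({p : V n | σ n g p ≠ p}.ncard : ℝ) / Fintype.card (V n))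
    atTop (𝓝 1)

/-- The enlarged maps `σ n g × Id` on `V n × W n`. -/
def enlarge {G : Type u} {V : ℕ → Type v} (σ : ∀ n, G → Equiv.Perm (V n)) (W : ℕ → Type w) :
    ∀ n, G → Equiv.Perm (V n × W n) :=
  fun n g => (σ n g).prodCongr (Equiv.refl (W n))

/-! ### Pullback names and empirical distributions -/

section Models

variable {G : Type u} {V : Type v} {X : Type z}

/-- The pullback name of `x` at the vertex `p`. -/
def pullbackName (s : G → Equiv.Perm V) (p : V) (x : V → X) : G → X :=
  fun g => x (s g p)

lemma measurable_pullbackName [MeasurableSpace X] (s : G → Equiv.Perm V) (p : V) :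
    Measurable (pullbackName (X := X) s p) :=
  measurable_pi_lambda _ fun g => measurable_pi_apply (s g p)

/-- The law of the pullback name at `p` of a random `x` with law `ν`. -/
def localLaw [MeasurableSpace X] (s : G → Equiv.Perm V) (ν : ProbabilityMeasure (V → X)) (p : V) :
    ProbabilityMeasure (G → X) :=
  ν.map (measurable_pullbackName s p).aemeasurable

/-- The empirical distribution of `x`, as a measure: `|V|⁻¹ ∑ₚ δ_(pullback name of x at p)`. -/
def empiricalMeasure [Fintype V] [MeasurableSpace X] (s : G → Equiv.Perm V) (x : V → X) :
    Measure (G → X) :=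
  (Fintype.card V : ENNReal)⁻¹ • ∑ p : V, Measure.dirac (pullbackName s p x)

lemma isProbabilityMeasure_empiricalMeasure [Fintype V] [Nonempty V] [MeasurableSpace X]
    (s : G → Equiv.Perm V) (x : V → X) : IsProbabilityMeasure (empiricalMeasure s x) := by
  constructor
  simp [empiricalMeasure, ENNReal.inv_mul_cancel]

/-- The empirical distribution of `x`. -/
def empirical [Fintype V] [Nonempty V] [MeasurableSpace X] (s : G → Equiv.Perm V) (x : V → X) :
    ProbabilityMeasure (G → X) :=
  ⟨empiricalMeasure s x, isProbabilityMeasure_empiricalMeasure s x⟩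

/-- The `U`-good models over `s`. -/
def goodModels [Fintype V] [Nonempty V] [MeasurableSpace X]
    (U : Set (ProbabilityMeasure (G → X))) (s : G → Equiv.Perm V) : Set (V → X) :=
  {x | empirical s x ∈ U}

end Models

/-! ### Modes of convergence

`ProbabilityMeasure (G → X)` carries Mathlib's topology of weak convergence, which is the weak-star
topology for compact metrizable `X` and countable `G`. -/

section Convergence

variable {G : Type u} [Countable G] {V : ℕ → Type v} [∀ n, Fintype (V n)]
  {X : Type z} [TopologicalSpace X] [SecondCountableTopology X] [MeasurableSpace X] [BorelSpace X]

/-- Local weak-star convergence of `ν n` to `μ` over `σ`. -/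
def LWConverges (σ : ∀ n, G → Equiv.Perm (V n)) (ν : ∀ n, ProbabilityMeasure (V n → X))
    (μ : ProbabilityMeasure (G → X)) : Prop :=
  ∀ U ∈ 𝓝 μ, Tendsto
    (fun n => ({p : V n | localLaw (σ n) (ν n) p ∈ U}.ncard : ℝ) / Fintype.card (V n))
    atTop (𝓝 1)

/-- Local and empirical convergence. -/
def LEConverges [∀ n, Nonempty (V n)] (σ : ∀ n, G → Equiv.Perm (V n))
    (ν : ∀ n, ProbabilityMeasure (V n → X)) (μ : ProbabilityMeasure (G → X)) : Prop :=
  LWConverges σ ν μ ∧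
    ∀ U ∈ 𝓝 μ, Tendsto (fun n => (ν n : Measure (V n → X)) (goodModels U (σ n))) atTop (𝓝 1)

/-- The product measure `μ × μ`, as a measure on `(X × X) ^ I` instead of `X ^ I × X ^ I`. -/
def square {I : Type w} {Y : Type z} [MeasurableSpace Y] (μ : ProbabilityMeasure (I → Y)) :
    ProbabilityMeasure (I → Y × Y) :=
  (μ.prod μ).map (f := fun q i => (q.1 i, q.2 i)) (by
    refine Measurable.aemeasurable (measurable_pi_lambda _ fun i => ?_)
    exact ((measurable_pi_apply i).comp measurable_fst).prodMk
      ((measurable_pi_apply i).comp measurable_snd))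

/-- Local and doubly empirical convergence: `ν n × ν n` LE-converges to `μ × μ`. -/
def LDEConverges [∀ n, Nonempty (V n)] (σ : ∀ n, G → Equiv.Perm (V n))
    (ν : ∀ n, ProbabilityMeasure (V n → X)) (μ : ProbabilityMeasure (G → X)) : Prop :=
  LEConverges σ (fun n => square (ν n)) (square μ)

end Convergence

/-! ### Model-measure sofic entropy -/

/-- The Hamming average of the metric of `X`. -/
def hammingAverage {V : Type v} [Fintype V] {X : Type z} [MetricSpace X] (x y : V → X) : ℝ :=
  (∑ p, dist (x p) (y p)) / Fintype.card V

/-- The least number of `δ`-balls for the Hamming average that are needed to cover more than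
`1 - ε` of the measure `ν`. -/
def coveringNumber {V : Type v} [Fintype V] {X : Type z} [MetricSpace X] [MeasurableSpace X]
    (ν : ProbabilityMeasure (V → X)) (ε δ : ℝ) : ℕ∞ :=
  ⨅ (F : Finset (V → X))
    (_ : 1 - ε < (ν : Measure (V → X)).real (⋃ c ∈ F, {x | hammingAverage x c < δ})),
    (F.card : ℕ∞)

/-- The model-measure sofic entropy of `μ` rel `σ`, with value `⊥ = -∞` if no measures
LDE-converge to `μ` along any subsequence. -/
def modelMeasureEntropy {G : Type u} [Countable G] {V : ℕ → Type v} [∀ n, Fintype (V n)]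
    [∀ n, Nonempty (V n)] {X : Type z} [MetricSpace X] [CompactSpace X] [MeasurableSpace X]
    [BorelSpace X] (σ : ∀ n, G → Equiv.Perm (V n)) (μ : ProbabilityMeasure (G → X)) : EReal :=
  ⨆ (n : ℕ → ℕ) (_ : StrictMono n) (ν : ∀ i, ProbabilityMeasure (V (n i) → X))
    (_ : LDEConverges (fun i => σ (n i)) ν μ) (ε : ℝ) (_ : 0 < ε) (δ : ℝ) (_ : 0 < δ),
    limsup (fun i => ENNReal.log (coveringNumber (ν i) ε δ : ENNReal) / Fintype.card (V (n i)))
      atTop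

/-! ### Partitions and Shannon entropy -/

/-- A finite Borel (measurable) partition of `X` into non-empty cells. -/
structure FinitePartition (X : Type z) [MeasurableSpace X] where
  cells : Finset (Set X)
  isPartition : Setoid.IsPartition (cells : Set (Set X))
  measurableSet : ∀ C ∈ cells, MeasurableSet C

/-- The Shannon entropy (in nats) of a finite partition. -/
def FinitePartition.entropy {X : Type z} [MeasurableSpace X] (P : FinitePartition X)
    (ν : ProbabilityMeasure X) : ℝ :=
  ∑ C ∈ P.cells, Real.negMulLog ((ν : Measure X).real C)

open Classical in
/-- The partition of `X ^ V` into products of cells of `P`. -/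
def FinitePartition.power {X : Type z} [MeasurableSpace X] (P : FinitePartition X)
    (V : Type v) [Fintype V] : FinitePartition (V → X) where
  cells := (Fintype.piFinset fun _ : V => P.cells).image fun C => Set.univ.pi C
  isPartition := by
    refine ⟨?_, fun x => ?_⟩
    · intro h
      simp only [Finset.coe_image, Set.mem_image, Finset.mem_coe, Fintype.mem_piFinset] at h
      obtain ⟨C, hC, h0⟩ := h
      obtain ⟨p, hp⟩ := Set.univ_pi_eq_empty_iff.1 h0
      exact P.isPartition.1 (hp ▸ hC p)
    · choose C hC hu using fun p => P.isPartition.2 (x p)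
      refine ⟨Set.univ.pi C, ⟨?_, fun p _ => (hC p).2⟩, ?_⟩
      · simp only [Finset.coe_image, Set.mem_image, Finset.mem_coe, Fintype.mem_piFinset]
        exact ⟨C, fun p => (hC p).1, rfl⟩
      · rintro D ⟨hD, hx⟩
        simp only [Finset.coe_image, Set.mem_image, Finset.mem_coe, Fintype.mem_piFinset] at hD
        obtain ⟨E, hE, rfl⟩ := hD
        congr 1
        funext p
        exact hu p (E p) ⟨hE p, hx p trivial⟩
  measurableSet := by
    intro D hD
    simp only [Finset.mem_image, Fintype.mem_piFinset] at hD
    obtain ⟨C, hC, rfl⟩ := hD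
    exact MeasurableSet.univ_pi fun p => P.measurableSet _ (hC p)

/-- The two compatibility properties of a family of finite Borel partitions: it has members of
arbitrarily small mesh, and all cells of all members are continuity sets for the marginal of `μ` at
the identity element of `G`. -/
structure IsCompatibleFamily {G : Type u} [Group G] {X : Type z} [MetricSpace X]
    [MeasurableSpace X] (𝔓 : Set (FinitePartition X)) (μ : ProbabilityMeasure (G → X)) : Prop where
  mesh : ∀ δ : ℝ, 0 < δ → ∃ P ∈ 𝔓, ∀ C ∈ P.cells, Metric.diam C < δ
  continuity : ∀ P ∈ 𝔓, ∀ C ∈ P.cells, (μ : Measure (G → X)) {x | x 1 ∈ frontier C} = 0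

/-- The supremum of the upper exponential growth rates of the Shannon entropies of `P ^ V`, over all
`P ∈ 𝔓` and all sequences of measures that locally weak-star converge to `μ` along a subsequence,
with value `⊥ = -∞` if there are no such sequences. -/
def localShannonEntropy {G : Type u} [Countable G] {V : ℕ → Type v} [∀ n, Fintype (V n)]
    {X : Type z} [MetricSpace X] [CompactSpace X] [MeasurableSpace X] [BorelSpace X]
    (σ : ∀ n, G → Equiv.Perm (V n)) (μ : ProbabilityMeasure (G → X))
    (𝔓 : Set (FinitePartition X)) : EReal :=
  ⨆ (P : FinitePartition X) (_ : P ∈ 𝔓) (n : ℕ → ℕ) (_ : StrictMono n)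
    (ν : ∀ i, ProbabilityMeasure (V (n i) → X)) (_ : LWConverges (fun i => σ (n i)) ν μ),
    limsup (fun i => (((P.power (V (n i))).entropy (ν i) / Fintype.card (V (n i)) : ℝ) : EReal))
      atTop

end SoficEntropy

end

/-! The two inequalities come from opposite operations on measures: taking independent copies
indexed by `W n`, and averaging over the slices `V n × {q}`.

For `≥`, let `ν n` converge locally to `μ`. The enlarged permutations preserve every slice, so the
power of `ν n` indexed by `W n` has the same local laws as `ν n`. The empirical distribution of a
sample is an average of `|W n|` independent terms whose expectation is the vertex average of the
local laws; as `|W n| → ∞`, Chebyshev's inequality makes it concentrate near `μ`. The same argument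
applied to `ν n × ν n` gives doubly empirical convergence (`LWConverges.ldeConverges_iidPower`).
Entropy per vertex is unchanged by taking independent copies, and Fano's inequality
(`FinitePartition.entropy_power_le_of_cover`) bounds it by the logarithm of a covering number, up to
a small error per vertex. Continuity of the cells enters here: points at small distance lie in the
same cell unless they are near a boundary, and by the portmanteau theorem this is rare.

For `≤`, let `ν n` be doubly empirically convergent over the enlarged maps, and let `P` have mesh
below `δ`. Conditioning `ν n` on the union of the light cells of `P ^ (V n × W n)` gives a measure
with entropy at least the logarithm of the covering number plus `log ε`
(`FinitePartition.exists_cond_entropy_ge`). This conditioning may destroy empirical convergence but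
not local convergence: the vertex average of the squared errors of local integrals is an integral
against the squared measure, which grows by a factor of at most `ε⁻²`
(`LDEConverges.tendsto_average_sq_cond`). Averaging over slices preserves local convergence by
Cauchy–Schwarz, and does not lower the entropy per vertex, by subadditivity and concavity
(`FinitePartition.entropy_power_prod_le`). -/

noncomputable section

namespace SoficEntropy

universe u v w z

/-! ### Shannon entropy of finite partitions -/

/-- Gibbs' inequality. -/
lemma sum_negMulLog_le_neg_sum_mul_log {β : Type*} [Fintype β] {p q : β → ℝ} (hp : ∀ b, 0 ≤ p b)
    (hp1 : ∑ b, p b = 1) (hq : ∀ b, 0 ≤ q b) (hq1 : ∑ b, q b ≤ 1)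
    (hpq : ∀ b, q b = 0 → p b = 0) :
    ∑ b, Real.negMulLog (p b) ≤ -∑ b, p b * Real.log (q b) := by
  -- This is `log x ≤ x - 1` at `x = q / p`. After summation the right-hand side is at most `1 - 1 =
  -- 0`.
  have key : ∀ b, Real.negMulLog (p b) + p b * Real.log (q b) ≤ q b - p b := by
    intro b
    rcases (hp b).eq_or_lt with h | h
    · simp [← h, hq b]
    · have hqb : 0 < q b := (hq b).lt_of_ne fun h0 => h.ne' (hpq b h0.symm)
      have h1 := Real.log_le_sub_one_of_pos (div_pos hqb h)
      rw [Real.log_div hqb.ne' h.ne'] at h1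
      have h2 := mul_le_mul_of_nonneg_left h1 h.le
      have h3 : p b * (q b / p b - 1) = q b - p b := by field_simp
      rw [h3] at h2
      simp only [Real.negMulLog]
      linarith
  have h := Finset.sum_le_sum fun b (_ : b ∈ Finset.univ) => key b
  rw [Finset.sum_add_distrib, Finset.sum_sub_distrib] at h
  linarith

section Label

variable {X : Type z} [MeasurableSpace X] (P : FinitePartition X)

/-- The cell of a point. -/
def FinitePartition.label (x : X) : P.cells :=
  ⟨(P.isPartition.2 x).choose, (P.isPartition.2 x).choose_spec.1.1⟩

lemma FinitePartition.mem_label (x : X) : x ∈ (P.label x : Set X) :=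
  (P.isPartition.2 x).choose_spec.1.2

lemma FinitePartition.label_eq_iff {x : X} {C : P.cells} : P.label x = C ↔ x ∈ (C : Set X) := by
  constructor
  · rintro rfl
    exact P.mem_label x
  · intro h
    refine Subtype.ext ?_
    exact (P.isPartition.2 x).unique ⟨(P.label x).2, P.mem_label x⟩ ⟨C.2, h⟩

/-- The cell of `P ^ V` with prescribed coordinates. -/
def FinitePartition.box {V : Type v} (c : V → P.cells) : Set (V → X) :=
  Set.univ.pi fun p => (c p : Set X)

/-- The coordinates of the cell of `P ^ V` containing a point. -/
def FinitePartition.name {V : Type v} (x : V → X) : V → P.cells := fun p => P.label (x p)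

lemma FinitePartition.mem_box_iff {V : Type v} {c : V → P.cells} {x : V → X} :
    x ∈ P.box c ↔ P.name x = c := by
  simp [box, name, Set.mem_pi, funext_iff, P.label_eq_iff]

lemma FinitePartition.box_nonempty {V : Type v} (c : V → P.cells) : (P.box c).Nonempty := by
  refine Set.univ_pi_nonempty_iff.2 fun p => Set.nonempty_iff_ne_empty.2 fun h => ?_
  exact P.isPartition.1 (h ▸ (c p).2)

lemma FinitePartition.measurableSet_box {V : Type v} [Countable V] (c : V → P.cells) :
    MeasurableSet (P.box c) :=
  MeasurableSet.univ_pi fun p => P.measurableSet _ (c p).2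

lemma FinitePartition.entropy_power {V : Type v} [Fintype V] [DecidableEq V]
    (ν : ProbabilityMeasure (V → X)) :
    (P.power V).entropy ν =
      ∑ c : V → P.cells, Real.negMulLog ((ν : Measure (V → X)).real (P.box c)) := by
  classical
  have hinj : Function.Injective (fun c : V → P.cells => P.box c) := by
    intro c c' h
    obtain ⟨x, hx⟩ := P.box_nonempty c
    have hx' : x ∈ P.box c' := by rw [← show P.box c = P.box c' from h]; exact hx
    rw [P.mem_box_iff] at hx hx'
    exact hx.symm.trans hx'
  have hcells : (P.power V).cells = Finset.univ.image fun c : V → P.cells => P.box c := by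
    ext D
    simp only [power, Finset.mem_image, Fintype.mem_piFinset, Finset.mem_univ, true_and]
    constructor
    · rintro ⟨C, hC, rfl⟩
      exact ⟨fun p => ⟨C p, hC p⟩, rfl⟩
    · rintro ⟨c, rfl⟩
      exact ⟨fun p => (c p : Set X), fun p => (c p).2, rfl⟩
  rw [entropy, hcells, Finset.sum_image fun a _ b _ h => hinj h]

variable {V : Type v} [Fintype V] [DecidableEq V]

/-- This exhibits functions of the name as simple functions, so that their integrals become finite
sums over cells. -/
lemma FinitePartition.comp_name_eq_sum (g : (V → P.cells) → ℝ) (x : V → X) :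
    g (P.name x) = ∑ c, (P.box c).indicator (fun _ => g c) x := by
  classical
  rw [Finset.sum_eq_single (P.name x)]
  · rw [Set.indicator_of_mem (P.mem_box_iff.2 rfl)]
  · intro c _ hc
    exact Set.indicator_of_notMem (fun h => hc (P.mem_box_iff.1 h).symm) _
  · simp

lemma FinitePartition.integrable_comp_name (ν : Measure (V → X)) [IsFiniteMeasure ν]
    (g : (V → P.cells) → ℝ) : Integrable (fun x => g (P.name x)) ν := by
  simp_rw [P.comp_name_eq_sum g]
  exact integrable_finsetSum _ fun c _ =>
    (integrable_const _).indicator (P.measurableSet_box c)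

lemma FinitePartition.integral_comp_name (ν : Measure (V → X)) [IsFiniteMeasure ν]
    (g : (V → P.cells) → ℝ) :
    ∫ x, g (P.name x) ∂ν = ∑ c, ν.real (P.box c) * g c := by
  simp_rw [P.comp_name_eq_sum g]
  rw [integral_finsetSum _ fun c _ => (integrable_const _).indicator (P.measurableSet_box c)]
  exact Finset.sum_congr rfl fun c _ => by
    rw [integral_indicator_const _ (P.measurableSet_box c), smul_eq_mul]

lemma FinitePartition.sum_box (ν : Measure (V → X)) [IsProbabilityMeasure ν] :
    ∑ c, ν.real (P.box (V := V) c) = 1 := by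
  have := P.integral_comp_name ν fun _ => 1
  simpa using this.symm

/-- The entropy is bounded by the cross entropy with any distribution. -/
lemma FinitePartition.entropy_power_le_integral (ν : ProbabilityMeasure (V → X))
    {q : (V → P.cells) → ℝ} (hq : ∀ c, 0 ≤ q c) (hq1 : ∑ c, q c ≤ 1)
    (h : ∀ c, q c = 0 → (ν : Measure (V → X)).real (P.box c) = 0) :
    (P.power V).entropy ν ≤ ∫ x, -Real.log (q (P.name x)) ∂(ν : Measure (V → X)) := by
  rw [P.entropy_power, P.integral_comp_name (ν : Measure (V → X)) fun c => -Real.log (q c)]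
  refine (sum_negMulLog_le_neg_sum_mul_log (fun c => measureReal_nonneg) (P.sum_box _) hq hq1
    h).trans_eq ?_
  simp

end Label

/-! ### Averages over slices -/

section Slice

variable {V : Type v} {W : Type w} {X : Type z} [MeasurableSpace X]

/-- The restriction of `x` to `V × {q}`. -/
def slice (q : W) (x : V × W → X) : V → X := fun p => x (p, q)

lemma measurable_slice (q : W) : Measurable (slice (V := V) (X := X) q) :=
  measurable_pi_lambda _ fun p => measurable_pi_apply (p, q)

lemma measurable_uncurrySwap :
    Measurable (fun (x : W → V → X) (p : V × W) => x p.2 p.1) :=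
  measurable_pi_lambda _ fun p => (measurable_pi_apply p.1).comp (measurable_pi_apply p.2)

variable [Fintype W]

/-- The law of independent samples of `ν`, indexed by `W`. -/
def iidPower (W : Type w) [Fintype W] (ν : ProbabilityMeasure (V → X)) :
    ProbabilityMeasure (V × W → X) :=
  (ProbabilityMeasure.pi fun _ : W => ν).map (f := fun x p => x p.2 p.1)
    measurable_uncurrySwap.aemeasurable

lemma coe_iidPower (ν : ProbabilityMeasure (V → X)) :
    (iidPower W ν : Measure (V × W → X)) =
      (Measure.pi fun _ : W => (ν : Measure (V → X))).map fun x p => x p.2 p.1 := rfl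

lemma map_slice_iidPower (ν : ProbabilityMeasure (V → X)) (q : W) :
    (iidPower W ν : Measure (V × W → X)).map (slice q) = ν := by
  rw [coe_iidPower, Measure.map_map (measurable_slice q) measurable_uncurrySwap]
  exact (measurePreserving_eval (fun _ : W => (ν : Measure (V → X))) q).map_eq

variable [Nonempty W]

/-- The average of the laws of the restrictions to `V × {q}`. -/
def sliceAverage (ν : ProbabilityMeasure (V × W → X)) : ProbabilityMeasure (V → X) :=
  ⟨(Fintype.card W : ENNReal)⁻¹ • ∑ q : W, (ν : Measure (V × W → X)).map (slice q), by
    constructor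
    have : ∀ q : W, ((ν : Measure (V × W → X)).map (slice q)) Set.univ = 1 := fun q => by
      rw [Measure.map_apply (measurable_slice q) MeasurableSet.univ]; simp
    simp [this, ENNReal.inv_mul_cancel]⟩

lemma coe_sliceAverage (ν : ProbabilityMeasure (V × W → X)) :
    (sliceAverage ν : Measure (V → X)) =
      (Fintype.card W : ENNReal)⁻¹ • ∑ q : W, (ν : Measure (V × W → X)).map (slice q) := rfl

lemma real_sliceAverage (ν : ProbabilityMeasure (V × W → X)) {E : Set (V → X)}
    (hE : MeasurableSet E) :
    (sliceAverage ν : Measure (V → X)).real E =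
      (∑ q : W, (ν : Measure (V × W → X)).real (slice q ⁻¹' E)) / Fintype.card W := by
  rw [coe_sliceAverage, measureReal_ennreal_smul_apply, measureReal_def, Measure.finsetSum_apply,
    ENNReal.toReal_sum]
  · simp_rw [Measure.map_apply (measurable_slice _) hE]
    simp [measureReal_def, div_eq_inv_mul]
  · exact fun q _ => by
      rw [Measure.map_apply (measurable_slice _) hE]; exact measure_ne_top _ _

lemma integral_sliceAverage (ν : ProbabilityMeasure (V × W → X)) {f : (V → X) → ℝ}
    (hf : Measurable f) {C : ℝ} (hC : ∀ x, |f x| ≤ C) :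
    ∫ x, f x ∂(sliceAverage ν : Measure (V → X)) =
      (∑ q : W, ∫ x, f (slice q x) ∂(ν : Measure (V × W → X))) / Fintype.card W := by
  rw [coe_sliceAverage, integral_smul_measure, integral_finsetSum_measure]
  · simp_rw [integral_map (measurable_slice _).aemeasurable hf.aestronglyMeasurable]
    simp [div_eq_inv_mul]
  · intro q _
    have : IsFiniteMeasure ((ν : Measure (V × W → X)).map (slice q)) :=
      Measure.isFiniteMeasure_map _ _
    exact Integrable.of_bound hf.aestronglyMeasurable C (ae_of_all _ hC)

lemma sliceAverage_iidPower (ν : ProbabilityMeasure (V → X)) :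
    sliceAverage (iidPower W ν) = ν := by
  refine Subtype.ext ?_
  change (sliceAverage (iidPower W ν) : Measure (V → X)) = ν
  rw [coe_sliceAverage]
  simp only [map_slice_iidPower, Finset.sum_const, Finset.card_univ]
  rw [← Nat.cast_smul_eq_nsmul ENNReal, smul_smul, ENNReal.inv_mul_cancel (by simp) (by simp),
    one_smul]

variable [Fintype V] (P : FinitePartition X)

/-- This is the absolute continuity needed in Gibbs' inequality when the reference law is the
product of the slice averages; it also excludes logarithms of zero. -/
lemma FinitePartition.slice_preimage_box_null (ν : ProbabilityMeasure (V × W → X))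
    {c : V × W → P.cells} {q : W}
    (h : (sliceAverage ν : Measure (V → X)).real (P.box fun p => c (p, q)) = 0) :
    (ν : Measure (V × W → X)).real (P.box c) = 0 := by
  rw [real_sliceAverage ν (P.measurableSet_box _), div_eq_zero_iff] at h
  have hW : (Fintype.card W : ℝ) ≠ 0 := by positivity
  have h2 := (Finset.sum_eq_zero_iff_of_nonneg fun q _ => measureReal_nonneg).1
    (h.resolve_right hW) q (Finset.mem_univ q)
  refine le_antisymm ((measureReal_mono ?_).trans_eq h2) measureReal_nonneg
  intro x hx
  rw [P.mem_box_iff] at hx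
  subst hx
  exact P.mem_box_iff.2 rfl

variable [DecidableEq V] [DecidableEq W]

/-- The term of index `q` sees only the law of the slice at `q`. Summing these laws over `q` gives
`|W|` times the slice average, so the cross entropy collapses to one Shannon entropy. -/
lemma FinitePartition.sum_box_mul_sum_log (ν : ProbabilityMeasure (V × W → X)) :
    ∑ c, (ν : Measure (V × W → X)).real (P.box c) * ∑ q : W,
      Real.log ((sliceAverage ν : Measure (V → X)).real (P.box fun p => c (p, q))) =
      -(Fintype.card W * (P.power V).entropy (sliceAverage ν)) := by
  set m : (V → P.cells) → ℝ := fun b => (sliceAverage ν : Measure (V → X)).real (P.box b) with hm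
  have h1 : ∀ q : W, ∑ c, (ν : Measure (V × W → X)).real (P.box c) *
      Real.log (m fun p => c (p, q)) =
      ∑ b, (ν : Measure (V × W → X)).real (slice q ⁻¹' P.box b) * Real.log (m b) := by
    intro q
    rw [← P.integral_comp_name (ν : Measure (V × W → X)) fun c => Real.log (m fun p => c (p, q))]
    have : IsProbabilityMeasure ((ν : Measure (V × W → X)).map (slice q)) :=
      Measure.isProbabilityMeasure_map (measurable_slice q).aemeasurable
    have h2 := P.integral_comp_name ((ν : Measure (V × W → X)).map (slice q))
      fun b => Real.log (m b)
    rw [integral_map (measurable_slice q).aemeasurable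
      (P.integrable_comp_name _ fun b => Real.log (m b)).aestronglyMeasurable] at h2
    refine Eq.trans h2 (Finset.sum_congr rfl fun b _ => ?_)
    rw [map_measureReal_apply (measurable_slice q) (P.measurableSet_box b)]
  simp_rw [Finset.mul_sum]
  rw [Finset.sum_comm]
  refine (Finset.sum_congr rfl fun q _ => h1 q).trans ?_
  rw [Finset.sum_comm, P.entropy_power, Finset.mul_sum, ← Finset.sum_neg_distrib]
  refine Finset.sum_congr rfl fun b _ => ?_
  rw [← Finset.sum_mul]
  have hW : (Fintype.card W : ℝ) ≠ 0 := by positivity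
  have h3 : ∑ q : W, (ν : Measure (V × W → X)).real (slice q ⁻¹' P.box b) =
      Fintype.card W * m b := by
    rw [hm]
    simp only
    rw [real_sliceAverage ν (P.measurableSet_box b)]
    field_simp
  rw [h3, Real.negMulLog]
  ring

lemma FinitePartition.sum_box_mul_log_prod (ν : ProbabilityMeasure (V × W → X)) :
    ∑ c, (ν : Measure (V × W → X)).real (P.box c) * Real.log (∏ q : W,
      (sliceAverage ν : Measure (V → X)).real (P.box fun p => c (p, q))) =
      -(Fintype.card W * (P.power V).entropy (sliceAverage ν)) := by
  rw [← P.sum_box_mul_sum_log ν]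
  refine Finset.sum_congr rfl fun c _ => ?_
  by_cases h : (ν : Measure (V × W → X)).real (P.box c) = 0
  · simp [h]
  · rw [Real.log_prod fun q _ h0 => h (P.slice_preimage_box_null ν h0)]

/-- Subadditivity and concavity of entropy, combined. -/
lemma FinitePartition.entropy_power_prod_le (ν : ProbabilityMeasure (V × W → X)) :
    (P.power (V × W)).entropy ν ≤ Fintype.card W * (P.power V).entropy (sliceAverage ν) := by
  rw [← neg_neg (Fintype.card W * (P.power V).entropy (sliceAverage ν)),
    ← P.sum_box_mul_log_prod ν, P.entropy_power]
  -- Gibbs' inequality against the power of the slice average indexed by `W` gives subadditivity and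
  -- concavity at once.
  refine sum_negMulLog_le_neg_sum_mul_log (fun c => measureReal_nonneg) (P.sum_box _)
    (fun c => Finset.prod_nonneg fun q _ => measureReal_nonneg) ?_ ?_
  · let e : (V × W → P.cells) ≃ (W → V → P.cells) :=
      (Equiv.arrowCongr (Equiv.prodComm V W) (Equiv.refl _)).trans (Equiv.curry _ _ _)
    have h : ∑ c : V × W → P.cells, ∏ q : W,
        (sliceAverage ν : Measure (V → X)).real (P.box fun p => c (p, q)) =
        ∑ d : W → V → P.cells, ∏ q : W, (sliceAverage ν : Measure (V → X)).real (P.box (d q)) :=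
      Fintype.sum_equiv e _ _ fun c => rfl
    rw [h, ← Fintype.prod_sum fun (_ : W) (b : V → P.cells) =>
      (sliceAverage ν : Measure (V → X)).real (P.box b)]
    simp only [P.sum_box, Finset.prod_const_one, le_refl]
  · intro c hc
    obtain ⟨q, -, hq⟩ := Finset.prod_eq_zero_iff.1 hc
    exact P.slice_preimage_box_null ν hq

/-- For independent samples the reference law in the cross entropy is the law itself, so Gibbs'
inequality becomes an equality. -/
lemma FinitePartition.entropy_power_iidPower (ν : ProbabilityMeasure (V → X)) :
    (P.power (V × W)).entropy (iidPower W ν) = Fintype.card W * (P.power V).entropy ν := by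
  have h := P.sum_box_mul_log_prod (iidPower W ν)
  rw [sliceAverage_iidPower] at h
  rw [← neg_neg (Fintype.card W * (P.power V).entropy ν), ← h, P.entropy_power,
    ← Finset.sum_neg_distrib]
  refine Finset.sum_congr rfl fun c _ => ?_
  have h2 : (iidPower W ν : Measure (V × W → X)).real (P.box c) =
      ∏ q : W, (ν : Measure (V → X)).real (P.box fun p => c (p, q)) := by
    rw [coe_iidPower, map_measureReal_apply measurable_uncurrySwap (P.measurableSet_box c)]
    have : (fun (x : W → V → X) (p : V × W) => x p.2 p.1) ⁻¹' P.box c =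
        Set.univ.pi fun q => P.box fun p => c (p, q) := by
      ext x
      simp only [box, Set.mem_preimage, Set.mem_univ_pi]
      exact ⟨fun h q p => h (p, q), fun h p => h p.2 p.1⟩
    rw [this, measureReal_def, Measure.pi_pi, ENNReal.toReal_prod]
    rfl
  rw [h2, Real.negMulLog]
  ring

end Slice

/-! ### Covering numbers bound entropy from above -/

section Fano

/-- A noisy channel on a finite alphabet: with probability `t` the input is replaced by a uniformly
random letter. -/
def noisyChannel {α : Type*} [Fintype α] [DecidableEq α] (t : ℝ) (a b : α) : ℝ :=
  (if a = b then 1 - t else 0) + t / Fintype.card α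

variable {α : Type*} [Fintype α] [DecidableEq α] {t : ℝ}

lemma noisyChannel_pos (ht : 0 < t) (ht1 : t < 1) (a b : α) : 0 < noisyChannel t a b := by
  have : Nonempty α := ⟨a⟩
  have h : 0 < t / Fintype.card α := by positivity
  unfold noisyChannel
  split_ifs <;> linarith

lemma sum_noisyChannel (a : α) : ∑ b, noisyChannel t a b = 1 := by
  have : Nonempty α := ⟨a⟩
  have h : (Fintype.card α : ℝ) ≠ 0 := by positivity
  simp only [noisyChannel, Finset.sum_add_distrib, Finset.sum_ite_eq, Finset.mem_univ, if_true,
    Finset.sum_const, Finset.card_univ, nsmul_eq_mul]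
  field_simp
  ring

/-- The cost `-log (1 - t)` is charged in both cases, so that summing over coordinates gives a fixed
term plus a multiple of the number of mismatches. -/
lemma neg_log_noisyChannel_le (ht : 0 < t) (ht1 : t < 1) (a b : α) :
    -Real.log (noisyChannel t a b) ≤
      -Real.log (1 - t) + Real.log (Fintype.card α / t) * if a = b then 0 else 1 := by
  have : Nonempty α := ⟨a⟩
  have h : 0 < t / Fintype.card α := by positivity
  by_cases hab : a = b
  · simp only [noisyChannel, hab, if_true, mul_zero, add_zero, neg_le_neg_iff]
    exact Real.log_le_log (by linarith) (by linarith)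
  · simp only [noisyChannel, hab, if_false, mul_one, zero_add]
    rw [← Real.log_inv, inv_div]
    have : Real.log (1 - t) ≤ 0 := Real.log_nonpos (by linarith) (by linarith)
    linarith

omit [DecidableEq α] in
lemma log_card_div_nonneg [Nonempty α] (ht : 0 < t) (ht1 : t < 1) :
    0 ≤ Real.log (Fintype.card α / t) := by
  refine Real.log_nonneg ((one_le_div ht).2 ?_)
  have : (1 : ℝ) ≤ Fintype.card α := by exact_mod_cast Fintype.card_pos
  linarith

/-- The average over the inputs `a ∈ A` of the output distributions of independent noisy
channels. -/
def channelMixture {U : Type*} [Fintype U] (t : ℝ) {ι : Type*} (F : Finset ι) (a : ι → U → α)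
    (c : U → α) : ℝ :=
  (∑ i ∈ F, ∏ p, noisyChannel t (a i p) (c p)) / F.card

variable {U : Type*} [Fintype U] {ι : Type*} {F : Finset ι} {a : ι → U → α}

lemma channelMixture_pos (ht : 0 < t) (ht1 : t < 1) (hF : F.Nonempty) (c : U → α) :
    0 < channelMixture t F a c := by
  have : 0 < F.card := hF.card_pos
  exact div_pos (Finset.sum_pos (fun i _ => Finset.prod_pos fun p _ =>
    noisyChannel_pos ht ht1 _ _) hF) (by positivity)

lemma sum_channelMixture [DecidableEq U] (hF : F.Nonempty) :
    ∑ c : U → α, channelMixture t F a c = 1 := by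
  have hF0 : (F.card : ℝ) ≠ 0 := by exact_mod_cast hF.card_pos.ne'
  simp only [channelMixture]
  rw [← Finset.sum_div, Finset.sum_comm, div_eq_one_iff_eq hF0]
  have : ∀ i ∈ F, ∑ c : U → α, ∏ p, noisyChannel t (a i p) (c p) = 1 := fun i _ => by
    rw [← Fintype.prod_sum fun p b => noisyChannel t (a i p) b]
    simp only [sum_noisyChannel, Finset.prod_const_one]
  rw [Finset.sum_congr rfl this]
  simp

/-- Retaining only the summand of index `i` in the mixture costs `log |F|`; the rest is a sum over
independent coordinates. -/
lemma neg_log_channelMixture_le (ht : 0 < t) (ht1 : t < 1) {i : ι} (hi : i ∈ F) (c : U → α) :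
    -Real.log (channelMixture t F a c) ≤ Real.log F.card + Fintype.card U * -Real.log (1 - t) +
      Real.log (Fintype.card α / t) * ∑ p, if a i p = c p then (0 : ℝ) else 1 := by
  have hF0 : (0 : ℝ) < F.card := by exact_mod_cast Finset.card_pos.2 ⟨i, hi⟩
  have hpos : 0 < ∏ p, noisyChannel t (a i p) (c p) :=
    Finset.prod_pos fun p _ => noisyChannel_pos ht ht1 _ _
  have h1 : ∏ p, noisyChannel t (a i p) (c p) ≤ ∑ i ∈ F, ∏ p, noisyChannel t (a i p) (c p) :=
    Finset.single_le_sum (f := fun i => ∏ p, noisyChannel t (a i p) (c p))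
      (fun j _ => Finset.prod_nonneg fun p _ => (noisyChannel_pos ht ht1 _ _).le) hi
  have h2 : -Real.log (∏ p, noisyChannel t (a i p) (c p)) ≤ Fintype.card U * -Real.log (1 - t) +
      Real.log (Fintype.card α / t) * ∑ p, if a i p = c p then (0 : ℝ) else 1 := by
    rw [Real.log_prod fun p _ => (noisyChannel_pos ht ht1 _ _).ne', ← Finset.sum_neg_distrib]
    refine (Finset.sum_le_sum fun p _ => neg_log_noisyChannel_le ht ht1 _ _).trans_eq ?_
    rw [Finset.sum_add_distrib, Finset.mul_sum]
    simp
  have h3 := Real.log_le_log hpos h1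
  rw [channelMixture, Real.log_div (hpos.trans_le h1).ne' hF0.ne']
  linarith

variable {X : Type z} [MetricSpace X] [MeasurableSpace X] [BorelSpace X]

lemma measurable_hammingAverage (c : U → X) :
    Measurable fun x : U → X => hammingAverage x c := by
  unfold hammingAverage
  refine Measurable.div_const (Finset.measurable_sum _ fun p _ => ?_) _
  exact (continuous_id.dist continuous_const).measurable.comp (measurable_pi_apply p)

lemma measurableSet_cover (F : Finset (U → X)) (δ : ℝ) :
    MeasurableSet (⋃ c ∈ F, {x : U → X | hammingAverage x c < δ}) :=
  Finset.measurableSet_biUnion _ fun c _ => measurableSet_lt (measurable_hammingAverage c)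
    measurable_const

/-- A form of Fano's inequality: if most of `ν` is covered by `δ`-balls with centres in `F`, then
the entropy of `ν` is not much larger than the logarithm of the number of balls. -/
lemma FinitePartition.entropy_power_le_of_cover [Nonempty U] [DecidableEq U]
    (P : FinitePartition X) (ν : ProbabilityMeasure (U → X)) {F : Finset (U → X)} {ε δ r : ℝ}
    (hF : F.Nonempty) (hδ : 0 < δ) (hr : 0 < r) (ht : 0 < t) (ht1 : t < 1)
    {B : Set X} (hB : MeasurableSet B)
    (hBP : ∀ x y, dist x y < r → P.label x ≠ P.label y → x ∈ B)
    (hcov : 1 - ε < (ν : Measure (U → X)).real (⋃ c ∈ F, {x | hammingAverage x c < δ})) :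
    (P.power U).entropy ν ≤ Real.log F.card + Fintype.card U * -Real.log (1 - t) +
      Real.log (P.cells.card / t) * (Fintype.card U * (δ / r + ε) +
        ∑ p, (ν : Measure (U → X)).real {x | x p ∈ B}) := by
  classical
  have hcard : Fintype.card P.cells = P.cells.card := Fintype.card_coe _
  rw [← hcard]
  set S := ⋃ c ∈ F, {x : U → X | hammingAverage x c < δ} with hS
  have hSm : MeasurableSet S := measurableSet_cover F δ
  have hU : (0 : ℝ) < Fintype.card U := by positivity
  set b := Real.log (Fintype.card P.cells / t) with hb
  have hne : Nonempty P.cells := by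
    obtain ⟨c, -⟩ := hF
    exact ⟨P.label (c (Classical.arbitrary U))⟩
  have hb0 : 0 ≤ b := log_card_div_nonneg ht ht1
  obtain ⟨c₀, hc₀⟩ := id hF
  -- The reference law for Gibbs' inequality: pick a centre uniformly and send its name through the
  -- noisy channel.
  let q : (U → P.cells) → ℝ := channelMixture t F fun c => P.name c
  have hpt : ∀ x, -Real.log (q (P.name x)) ≤ Real.log F.card +
      Fintype.card U * -Real.log (1 - t) + b * (Fintype.card U * (S.indicator (fun _ => δ / r) x +
        Sᶜ.indicator (fun _ => 1) x) + ∑ p, ({x | x p ∈ B} : Set (U → X)).indicator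
          (fun _ => 1) x) := by
    intro x
    have hmis : ∀ c ∈ F, (∑ p, if P.name c p = P.name x p then (0 : ℝ) else 1) ≤
        Fintype.card U * (S.indicator (fun _ => δ / r) x +
        Sᶜ.indicator (fun _ => 1) x) + ∑ p, ({x | x p ∈ B} : Set (U → X)).indicator
          (fun _ => 1) x → -Real.log (q (P.name x)) ≤ _ := fun c hc h =>
      (neg_log_channelMixture_le ht ht1 hc (P.name x)).trans
        (add_le_add le_rfl (mul_le_mul_of_nonneg_left h hb0))
    by_cases hx : x ∈ S
    · have hx' := hx
      simp only [hS, Set.mem_iUnion, Set.mem_ofPred_eq] at hx'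
      obtain ⟨c, hc, hxc⟩ := hx'
      refine hmis c hc ?_
      -- A mismatch means either distance at least `r`, which is charged to the Hamming average, or
      -- a pair of close points in different cells, which forces `x p ∈ B`.
      have h1 : ∀ p, (if P.name c p = P.name x p then (0 : ℝ) else 1) ≤ dist (x p) (c p) / r +
          ({x | x p ∈ B} : Set (U → X)).indicator (fun _ => 1) x := by
        intro p
        have hi : 0 ≤ ({x | x p ∈ B} : Set (U → X)).indicator (fun _ => (1 : ℝ)) x :=
          Set.indicator_nonneg (fun _ _ => zero_le_one) _
        have hd : 0 ≤ dist (x p) (c p) / r := by positivity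
        split_ifs with h
        · positivity
        · rcases lt_or_ge (dist (x p) (c p)) r with hlt | hge
          · have : x p ∈ B := hBP _ _ hlt fun h' => h h'.symm
            rw [Set.indicator_of_mem (by exact this)]
            linarith
          · have : 1 ≤ dist (x p) (c p) / r := (one_le_div hr).2 hge
            linarith
      refine (Finset.sum_le_sum fun p _ => h1 p).trans ?_
      rw [Finset.sum_add_distrib, Set.indicator_of_mem hx, Set.indicator_of_notMem (by simpa),
        add_zero]
      refine add_le_add ?_ le_rfl
      rw [← Finset.sum_div, ← mul_div_assoc]
      refine div_le_div_of_nonneg_right ?_ hr.le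
      rw [hammingAverage, div_lt_iff₀ hU] at hxc
      linarith
    -- Off the covered set any centre serves, with every coordinate counted as a possible mismatch;
    -- this set has measure below `ε`.
    · refine hmis c₀ hc₀ ?_
      rw [Set.indicator_of_notMem hx, Set.indicator_of_mem (by simpa), zero_add, mul_one]
      have h1 : (∑ p, if P.name c₀ p = P.name x p then (0 : ℝ) else 1) ≤ ∑ _p : U, (1 : ℝ) :=
        Finset.sum_le_sum fun p _ => by split_ifs <;> norm_num
      have h2 : 0 ≤ ∑ p, ({x | x p ∈ B} : Set (U → X)).indicator (fun _ => (1 : ℝ)) x :=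
        Finset.sum_nonneg fun p _ => Set.indicator_nonneg (fun _ _ => zero_le_one) _
      simp only [Finset.sum_const, Finset.card_univ, nsmul_eq_mul, mul_one] at h1
      linarith
  have hBm : ∀ p, MeasurableSet ({x | x p ∈ B} : Set (U → X)) := fun p => measurable_pi_apply p hB
  have hi1 : ∀ (T : Set (U → X)) (_ : MeasurableSet T) (s : ℝ),
      Integrable (T.indicator fun _ => s) (ν : Measure (U → X)) := fun T hT s =>
    (integrable_const _).indicator hT
  have hint1 : Integrable (fun x => Fintype.card U * (S.indicator (fun _ => δ / r) x +
        Sᶜ.indicator (fun _ => 1) x)) (ν : Measure (U → X)) :=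
    ((hi1 S hSm _).add (hi1 Sᶜ hSm.compl _)).const_mul _
  have hint2 : Integrable (fun x => ∑ p, ({x | x p ∈ B} : Set (U → X)).indicator
      (fun _ => (1 : ℝ)) x) (ν : Measure (U → X)) :=
    integrable_finsetSum _ fun p _ => hi1 _ (hBm p) _
  have hint12 : Integrable (fun x => Fintype.card U * (S.indicator (fun _ => δ / r) x +
      Sᶜ.indicator (fun _ => 1) x) + ∑ p, ({x | x p ∈ B} : Set (U → X)).indicator
      (fun _ => (1 : ℝ)) x) (ν : Measure (U → X)) := hint1.add hint2
  refine (P.entropy_power_le_integral ν (q := q)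
    (fun c => (channelMixture_pos ht ht1 hF c).le) (sum_channelMixture hF).le
    fun c hc => absurd hc (channelMixture_pos ht ht1 hF c).ne').trans ?_
  refine (integral_mono (P.integrable_comp_name _ fun c => -Real.log (q c))
    ((integrable_const _).add (hint12.const_mul b)) hpt).trans ?_
  simp only [Pi.add_apply]
  rw [integral_add (integrable_const _) (hint12.const_mul b), integral_const_mul,
    integral_add hint1 hint2, integral_const_mul,
    integral_add (hi1 S hSm _) (hi1 Sᶜ hSm.compl _), integral_finsetSum _
      fun p _ => hi1 _ (hBm p) _]
  simp only [integral_indicator_const _ hSm, integral_indicator_const _ hSm.compl,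
    integral_indicator_const _ (hBm _), integral_const, probReal_univ, smul_eq_mul, one_mul,
    mul_one]
  refine add_le_add le_rfl (mul_le_mul_of_nonneg_left (add_le_add
    (mul_le_mul_of_nonneg_left ?_ hU.le) le_rfl) hb0)
  rw [probReal_compl_eq_one_sub hSm]
  have h1 : (ν : Measure (U → X)).real S * (δ / r) ≤ δ / r :=
    mul_le_of_le_one_left (by positivity) measureReal_le_one
  linarith

end Fano

/-! ### Convergence along sets of vertices of full density -/

section Density

variable {V : ℕ → Type v} [∀ n, Fintype (V n)] [∀ n, Nonempty (V n)]

lemma tendsto_ncard_div_iff_compl (S : ∀ n, Set (V n)) :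
    Tendsto (fun n => ((S n).ncard : ℝ) / Fintype.card (V n)) atTop (𝓝 1) ↔
      Tendsto (fun n => ((S n)ᶜ.ncard : ℝ) / Fintype.card (V n)) atTop (𝓝 0) := by
  have h : ∀ n, ((S n).ncard : ℝ) / Fintype.card (V n) =
      1 - ((S n)ᶜ.ncard : ℝ) / Fintype.card (V n) := fun n => by
    have h1 := Set.ncard_add_ncard_compl (S n)
    rw [Nat.card_eq_fintype_card] at h1
    have h2 : ((S n).ncard : ℝ) + (S n)ᶜ.ncard = Fintype.card (V n) := by exact_mod_cast h1
    have h3 : (0 : ℝ) < Fintype.card (V n) := by positivity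
    field_simp
    linarith
  simp_rw [h]
  constructor
  · intro H
    simpa using H.const_sub 1
  · intro H
    simpa using H.const_sub 1

/-- The filter of sets of vertices whose proportion converges to one. -/
def densityFilter (V : ℕ → Type v) [∀ n, Fintype (V n)] [∀ n, Nonempty (V n)] :
    Filter (Σ n, V n) where
  sets := {S | Tendsto (fun n => ({p : V n | ⟨n, p⟩ ∈ S}.ncard : ℝ) / Fintype.card (V n))
    atTop (𝓝 1)}
  univ_sets := by
    refine (tendsto_ncard_div_iff_compl _).2 ?_
    simp
  sets_of_superset := by
    intro S T hS hST
    refine (tendsto_ncard_div_iff_compl _).2 (squeeze_zero (fun n => by positivity) (fun n => ?_)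
      ((tendsto_ncard_div_iff_compl _).1 hS))
    refine div_le_div_of_nonneg_right (Nat.cast_le.2 (Set.ncard_le_ncard ?_)) (by positivity)
    exact Set.compl_subset_compl.2 fun p hp => hST hp
  inter_sets := by
    intro S T hS hT
    have hlim := ((tendsto_ncard_div_iff_compl _).1 hS).add ((tendsto_ncard_div_iff_compl _).1 hT)
    rw [add_zero] at hlim
    refine (tendsto_ncard_div_iff_compl _).2 (squeeze_zero (fun n => by positivity) (fun n => ?_)
      hlim)
    rw [← add_div]
    refine div_le_div_of_nonneg_right ?_ (by positivity)
    have : {p : V n | (⟨n, p⟩ : Σ n, V n) ∈ S ∩ T}ᶜ =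
        {p : V n | (⟨n, p⟩ : Σ n, V n) ∈ S}ᶜ ∪ {p : V n | (⟨n, p⟩ : Σ n, V n) ∈ T}ᶜ :=
      Set.compl_inter _ _
    rw [this]
    exact_mod_cast Set.ncard_union_le _ _

lemma mem_densityFilter_iff {S : Set (Σ n, V n)} : S ∈ densityFilter V ↔
    Tendsto (fun n => ({p : V n | ⟨n, p⟩ ∈ S}ᶜ.ncard : ℝ) / Fintype.card (V n)) atTop (𝓝 0) :=
  tendsto_ncard_div_iff_compl _

lemma ncard_eq_sum_indicator {U : Type*} [Fintype U] (S : Set U) :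
    (S.ncard : ℝ) = ∑ p, S.indicator (fun _ => 1) p := by
  classical
  rw [Set.ncard_eq_toFinset_card']
  simp [Set.indicator_apply, Set.toFinset]

/-- Markov's inequality for vertex averages. -/
lemma eventually_densityFilter_lt {f : ∀ n, V n → ℝ} (hf : ∀ n p, 0 ≤ f n p)
    (h : Tendsto (fun n => (∑ p, f n p) / Fintype.card (V n)) atTop (𝓝 0)) {η : ℝ} (hη : 0 < η) :
    ∀ᶠ x in densityFilter V, f x.1 x.2 < η := by
  refine mem_densityFilter_iff.2 (squeeze_zero (fun n => by positivity) (fun n => ?_)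
    (by simpa using h.div_const η))
  rw [div_right_comm]
  refine div_le_div_of_nonneg_right ?_ (by positivity)
  rw [ncard_eq_sum_indicator, Finset.sum_div]
  refine Finset.sum_le_sum fun p _ => ?_
  by_cases hp : f n p < η
  · rw [Set.indicator_of_notMem (by simpa using hp)]
    exact div_nonneg (hf n p) hη.le
  · rw [Set.indicator_of_mem (by simpa using hp)]
    exact (one_le_div hη).2 (not_lt.1 hp)

/-- The exceptional vertices have vanishing density and each contributes a bounded amount. -/
lemma eventually_average_le {f : ∀ n, V n → ℝ} {a C η : ℝ} (ha : 0 ≤ a) (hC : ∀ n p, f n p ≤ C)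
    (h : ∀ᶠ x in densityFilter V, f x.1 x.2 ≤ a) (hη : 0 < η) :
    ∀ᶠ n in atTop, (∑ p, f n p) / Fintype.card (V n) ≤ a + η := by
  have h1 := (mem_densityFilter_iff.1 h).mul_const |C|
  rw [zero_mul] at h1
  filter_upwards [h1.eventually (gt_mem_nhds hη)] with n hn
  refine le_trans ?_ (add_le_add le_rfl hn.le)
  have hV : (0 : ℝ) < Fintype.card (V n) := by positivity
  rw [ncard_eq_sum_indicator, div_mul_eq_mul_div, ← sub_le_iff_le_add, ← sub_div,
    div_le_iff₀ hV, sub_le_iff_le_add, Finset.sum_mul]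
  have h2 : a * Fintype.card (V n) = ∑ _p : V n, a := by simp [mul_comm]
  rw [h2, ← Finset.sum_add_distrib]
  refine Finset.sum_le_sum fun p _ => ?_
  by_cases hp : f n p ≤ a
  · rw [Set.indicator_of_notMem (by simpa using hp)]
    simpa
  · rw [Set.indicator_of_mem (by simpa using hp), one_mul]
    linarith [hC n p, le_abs_self C]

end Density

/-! ### Local weak-star convergence and averages -/

section Local

variable {G : Type u} {X : Type z}

lemma integral_localLaw [MeasurableSpace X] {U : Type v} (s : G → Equiv.Perm U)
    (ν : ProbabilityMeasure (U → X)) (p : U) {f : (G → X) → ℝ} (hf : Measurable f) :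
    ∫ x, f x ∂(localLaw s ν p : Measure (G → X)) =
      ∫ x, f (pullbackName s p x) ∂(ν : Measure (U → X)) := by
  change ∫ x, f x ∂((ν : Measure (U → X)).map (pullbackName s p)) = _
  rw [integral_map (measurable_pullbackName s p).aemeasurable hf.aestronglyMeasurable]

lemma real_localLaw [MeasurableSpace X] {U : Type v} (s : G → Equiv.Perm U)
    (ν : ProbabilityMeasure (U → X)) (p : U) {E : Set (G → X)} (hE : MeasurableSet E) :
    (localLaw s ν p : Measure (G → X)).real E =
      (ν : Measure (U → X)).real (pullbackName s p ⁻¹' E) := by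
  change ((ν : Measure (U → X)).map (pullbackName s p)).real E = _
  rw [map_measureReal_apply (measurable_pullbackName s p) hE]

variable [Countable G] {V : ℕ → Type v} [∀ n, Fintype (V n)] [∀ n, Nonempty (V n)]
  [TopologicalSpace X] [SecondCountableTopology X] [MeasurableSpace X] [BorelSpace X]
  {σ : ∀ n, G → Equiv.Perm (V n)} {ν : ∀ n, ProbabilityMeasure (V n → X)}
  {μ : ProbabilityMeasure (G → X)}

/-- Writing local convergence as a limit along one filter makes the standard criteria for weak
convergence available. -/
lemma lwConverges_iff_tendsto : LWConverges σ ν μ ↔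
    Tendsto (fun x : Σ n, V n => localLaw (σ x.1) (ν x.1) x.2) (densityFilter V) (𝓝 μ) :=
  Iff.rfl

lemma lwConverges_of_tendsto_average_sq
    (h : ∀ f : BoundedContinuousFunction (G → X) ℝ, Tendsto (fun n => (∑ p,
      (∫ x, f x ∂(localLaw (σ n) (ν n) p : Measure (G → X)) - ∫ x, f x ∂(μ : Measure (G → X))) ^ 2)
        / Fintype.card (V n)) atTop (𝓝 0)) : LWConverges σ ν μ := by
  rw [lwConverges_iff_tendsto, ProbabilityMeasure.tendsto_iff_forall_integral_tendsto]
  intro f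
  rw [Metric.tendsto_nhds]
  intro η hη
  filter_upwards [eventually_densityFilter_lt (fun n p => sq_nonneg _) (h f)
    (sq_pos_of_pos hη)] with x hx
  rw [Real.dist_eq]
  exact abs_lt_of_sq_lt_sq hx hη.le

lemma LWConverges.tendsto_average_integral (h : LWConverges σ ν μ)
    (f : BoundedContinuousFunction (G → X) ℝ) :
    Tendsto (fun n => (∑ p, ∫ x, f x ∂(localLaw (σ n) (ν n) p : Measure (G → X))) /
      Fintype.card (V n)) atTop (𝓝 (∫ x, f x ∂(μ : Measure (G → X)))) := by
  rw [lwConverges_iff_tendsto, ProbabilityMeasure.tendsto_iff_forall_integral_tendsto] at h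
  rw [Metric.tendsto_nhds]
  intro η hη
  have h1 : ∀ ρ : ProbabilityMeasure (G → X), |∫ x, f x ∂(ρ : Measure (G → X))| ≤ ‖f‖ := fun ρ =>
    f.norm_integral_le_norm _
  have h2 := (Metric.tendsto_nhds.1 (h f)) (η / 3) (by positivity)
  filter_upwards [eventually_average_le (f := fun n p =>
    |∫ x, f x ∂(localLaw (σ n) (ν n) p : Measure (G → X)) - ∫ x, f x ∂(μ : Measure (G → X))|)
    (a := η / 3) (C := ‖f‖ + ‖f‖) (η := η / 3) (by positivity)
    (fun n p => (abs_sub _ _).trans (add_le_add (h1 _) (h1 _)))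
    (h2.mono fun x hx => le_of_lt hx) (by positivity)] with n hn
  have hV : (0 : ℝ) < Fintype.card (V n) := by positivity
  rw [Real.dist_eq]
  refine lt_of_le_of_lt ?_ (show η / 3 + η / 3 < η by linarith)
  refine le_trans ?_ hn
  have h3 : (∑ p, ∫ x, f x ∂(localLaw (σ n) (ν n) p : Measure (G → X))) / Fintype.card (V n) -
      ∫ x, f x ∂(μ : Measure (G → X)) = (∑ p, (∫ x, f x ∂(localLaw (σ n) (ν n) p :
        Measure (G → X)) - ∫ x, f x ∂(μ : Measure (G → X)))) / Fintype.card (V n) := by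
    rw [Finset.sum_sub_distrib, sub_div]
    simp
  rw [h3, abs_div, abs_of_pos hV]
  exact div_le_div_of_nonneg_right (Finset.abs_sum_le_sum_abs _ _) hV.le

lemma LWConverges.eventually_average_real_le [HasOuterApproxClosed (G → X)]
    (h : LWConverges σ ν μ) {K : Set (G → X)} (hK : IsClosed K) {η : ℝ} (hη : 0 < η) :
    ∀ᶠ n in atTop, (∑ p, (localLaw (σ n) (ν n) p : Measure (G → X)).real K) /
      Fintype.card (V n) ≤ (μ : Measure (G → X)).real K + η := by
  have h1 : ∀ᶠ x in densityFilter V, (localLaw (σ x.1) (ν x.1) x.2 : Measure (G → X)) K <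
      (μ : Measure (G → X)) K + ENNReal.ofReal (η / 2) := by
    refine eventually_lt_of_limsup_lt (lt_of_le_of_lt
      (ProbabilityMeasure.limsup_measure_closed_le_of_tendsto (lwConverges_iff_tendsto.1 h) hK) ?_)
    exact ENNReal.lt_add_right (measure_ne_top _ _) (by simpa using hη)
  have h2 := eventually_average_le (V := V)
    (f := fun n p => (localLaw (σ n) (ν n) p : Measure (G → X)).real K)
    (a := (μ : Measure (G → X)).real K + η / 2) (C := 1) (η := η / 2) (by positivity)
    (fun n p => measureReal_le_one) (h1.mono fun x hx => ?_) (by positivity)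
  · filter_upwards [h2] with n hn
    linarith
  · refine (ENNReal.toReal_mono (by finiteness) hx.le).trans_eq ?_
    rw [ENNReal.toReal_add (measure_ne_top _ _) ENNReal.ofReal_ne_top,
      ENNReal.toReal_ofReal (by positivity)]
    rfl

end Local

/-! ### Neighbourhoods of the boundary of a partition -/

section Boundary

variable {X : Type z} [MetricSpace X] [MeasurableSpace X] [BorelSpace X]

/-- The points that are close both to a cell and to its complement. -/
def FinitePartition.boundaryNhd (P : FinitePartition X) (r : ℝ) : Set X :=
  ⋃ C ∈ P.cells, Metric.cthickening r C ∩ Metric.cthickening r Cᶜ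

omit [BorelSpace X] in
lemma FinitePartition.isClosed_boundaryNhd (P : FinitePartition X) (r : ℝ) :
    IsClosed (P.boundaryNhd r) :=
  Set.Finite.isClosed_biUnion P.cells.finite_toSet fun _ _ =>
    Metric.isClosed_cthickening.inter Metric.isClosed_cthickening

omit [BorelSpace X] in
lemma FinitePartition.mem_boundaryNhd (P : FinitePartition X) {r : ℝ} {x y : X}
    (h : dist x y < r) (hxy : P.label x ≠ P.label y) : x ∈ P.boundaryNhd r := by
  refine Set.mem_biUnion (P.label x).2 ⟨?_, ?_⟩
  · exact Metric.self_subset_cthickening _ (P.mem_label x)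
  · refine Metric.mem_cthickening_of_dist_le x y r _ ?_ h.le
    exact fun hy => hxy (P.label_eq_iff.2 hy).symm

lemma FinitePartition.exists_boundaryNhd_real_lt (P : FinitePartition X) {Y : Type*}
    [MeasurableSpace Y] (μ : Measure Y) [IsFiniteMeasure μ] {π : Y → X} (hπ : Measurable π)
    (hP : ∀ C ∈ P.cells, μ (π ⁻¹' frontier C) = 0) {η : ℝ} (hη : 0 < η) :
    ∃ r, 0 < r ∧ μ.real (π ⁻¹' P.boundaryNhd r) < η := by
  let s : ℕ → Set Y := fun n => π ⁻¹' P.boundaryNhd (1 / ((n : ℝ) + 1))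
  have hmono : ∀ r r' : ℝ, r ≤ r' → P.boundaryNhd r ⊆ P.boundaryNhd r' := fun r r' h =>
    Set.iUnion₂_mono fun C _ => Set.inter_subset_inter (Metric.cthickening_mono h _)
      (Metric.cthickening_mono h _)
  have hanti : Antitone s := fun m n hmn =>
    Set.preimage_mono (hmono _ _ (Nat.one_div_le_one_div hmn))
  have hlim := tendsto_measure_iInter_atTop (μ := μ) (s := s)
    (fun n => (hπ (P.isClosed_boundaryNhd _).measurableSet).nullMeasurableSet) hanti
    ⟨0, measure_ne_top _ _⟩
  have hzero : μ (⋂ n, s n) = 0 := by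
    refine measure_mono_null (t := ⋃ C ∈ P.cells, π ⁻¹' frontier C) ?_
      ((measure_biUnion_null_iff P.cells.countable_toSet).2 hP)
    intro y hy
    have h1 : ∀ n : ℕ, ∃ C ∈ P.cells, π y ∈ Metric.cthickening (1 / ((n : ℝ) + 1)) C ∩
        Metric.cthickening (1 / ((n : ℝ) + 1)) Cᶜ := fun n => by
      have := Set.mem_iInter.1 hy n
      simpa only [s, boundaryNhd, Set.mem_preimage, Set.mem_iUnion, exists_prop] using this
    -- Pigeonhole: there are finitely many cells, so a single one serves for arbitrarily small
    -- radii.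
    have h2 : ∃ C ∈ P.cells, ∃ᶠ n : ℕ in atTop, π y ∈ Metric.cthickening (1 / ((n : ℝ) + 1)) C ∩
        Metric.cthickening (1 / ((n : ℝ) + 1)) Cᶜ := by
      by_contra! hcon
      have : ∀ᶠ n : ℕ in atTop, ∀ C ∈ P.cells, π y ∉ Metric.cthickening (1 / ((n : ℝ) + 1)) C ∩
          Metric.cthickening (1 / ((n : ℝ) + 1)) Cᶜ :=
        (Filter.eventually_all_finset _).2 fun C hC => hcon C hC
      obtain ⟨n, hn⟩ := this.exists
      obtain ⟨C, hC, hy⟩ := h1 n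
      exact hn C hC hy
    obtain ⟨C, hC, hfreq⟩ := h2
    have h3 : ∀ r : ℝ, 0 < r → π y ∈ Metric.cthickening r C ∩ Metric.cthickening r Cᶜ := by
      intro r hr
      obtain ⟨n, hn, hnr⟩ := (hfreq.and_eventually
        (tendsto_one_div_add_atTop_nhds_zero_nat.eventually (gt_mem_nhds hr))).exists
      exact ⟨Metric.cthickening_mono hnr.le _ hn.1, Metric.cthickening_mono hnr.le _ hn.2⟩
    refine Set.mem_biUnion hC ?_
    rw [Set.mem_preimage, frontier_eq_closure_inter_closure,
      Metric.closure_eq_iInter_cthickening, Metric.closure_eq_iInter_cthickening]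
    exact ⟨Set.mem_iInter₂.2 fun r hr => (h3 r hr).1, Set.mem_iInter₂.2 fun r hr => (h3 r hr).2⟩
  rw [hzero] at hlim
  obtain ⟨n, hn⟩ := (hlim.eventually (gt_mem_nhds (ENNReal.ofReal_pos.2 hη))).exists
  refine ⟨1 / ((n : ℝ) + 1), by positivity, ?_⟩
  have := ENNReal.toReal_strict_mono ENNReal.ofReal_ne_top hn
  rwa [ENNReal.toReal_ofReal hη.le] at this

end Boundary

/-! ### Models of high probability -/

section Empirical

variable {G : Type u} {X : Type z}

lemma integral_empirical [MeasurableSpace X] {U : Type v} [Fintype U] [Nonempty U]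
    (s : G → Equiv.Perm U) (x : U → X) {f : (G → X) → ℝ} (hf : Measurable f) :
    ∫ y, f y ∂(empirical s x : Measure (G → X)) =
      (∑ p, f (pullbackName s p x)) / Fintype.card U := by
  change ∫ y, f y ∂(empiricalMeasure s x) = _
  rw [empiricalMeasure, integral_smul_measure, integral_finsetSum_measure]
  · simp_rw [integral_dirac' f _ hf.stronglyMeasurable]
    simp [div_eq_inv_mul]
  · exact fun p _ => integrable_dirac' hf.stronglyMeasurable (by finiteness)

/-- The filter of sets of models whose probability converges to one. -/
def modelFilter {V : ℕ → Type v} [MeasurableSpace X] (ν : ∀ n, ProbabilityMeasure (V n → X)) :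
    Filter (Σ n, V n → X) where
  sets := {S | Tendsto (fun n => (ν n : Measure (V n → X)) {x | ⟨n, x⟩ ∈ S}ᶜ) atTop (𝓝 0)}
  univ_sets := by simp
  sets_of_superset := by
    intro S T hS hST
    exact tendsto_of_tendsto_of_tendsto_of_le_of_le tendsto_const_nhds hS
      (fun n => zero_le) fun n => measure_mono (Set.compl_subset_compl.2 fun x hx => hST hx)
  inter_sets := by
    intro S T hS hT
    have h := Tendsto.add (show Tendsto _ _ _ from hS) (show Tendsto _ _ _ from hT)
    rw [add_zero] at h
    refine tendsto_of_tendsto_of_tendsto_of_le_of_le tendsto_const_nhds h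
      (fun n => zero_le) fun n => ?_
    have : {x : V n → X | (⟨n, x⟩ : Σ n, V n → X) ∈ S ∩ T}ᶜ =
        {x | (⟨n, x⟩ : Σ n, V n → X) ∈ S}ᶜ ∪ {x | (⟨n, x⟩ : Σ n, V n → X) ∈ T}ᶜ :=
      Set.compl_inter _ _
    rw [this]
    exact measure_union_le _ _

variable [Countable G] {V : ℕ → Type v} [∀ n, Fintype (V n)] [∀ n, Nonempty (V n)]
  [TopologicalSpace X] [SecondCountableTopology X] [MeasurableSpace X] [BorelSpace X]
  {σ : ∀ n, G → Equiv.Perm (V n)} {ν : ∀ n, ProbabilityMeasure (V n → X)}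
  {μ : ProbabilityMeasure (G → X)}

lemma tendsto_goodModels_of_tendsto_integral
    (h : ∀ (f : BoundedContinuousFunction (G → X) ℝ) (η : ℝ), 0 < η → Tendsto (fun n =>
      (ν n : Measure (V n → X)) {x | η ≤ |∫ y, f y ∂(empirical (σ n) x : Measure (G → X)) -
        ∫ y, f y ∂(μ : Measure (G → X))|}) atTop (𝓝 0)) (U : Set (ProbabilityMeasure (G → X)))
    (hU : U ∈ 𝓝 μ) :
    Tendsto (fun n => (ν n : Measure (V n → X)) (goodModels U (σ n))) atTop (𝓝 1) := by
  have h1 : Tendsto (fun x : Σ n, V n → X => empirical (σ x.1) x.2) (modelFilter ν) (𝓝 μ) := by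
    rw [ProbabilityMeasure.tendsto_iff_forall_integral_tendsto]
    intro f
    rw [Metric.tendsto_nhds]
    intro η hη
    have h2 := h f η hη
    change Tendsto (fun n => (ν n : Measure (V n → X)) {x | dist _ _ < η}ᶜ) atTop (𝓝 0)
    convert! h2 using 3 with n
    ext x
    simp [Real.dist_eq]
  have h3 : Tendsto (fun n => (ν n : Measure (V n → X)) (goodModels U (σ n))ᶜ) atTop (𝓝 0) :=
    h1 hU
  -- For an arbitrary neighbourhood `U` the set of good models need not be measurable, so only
  -- subadditivity relates it to its complement.
  have h4 := ENNReal.Tendsto.sub (tendsto_const_nhds (x := (1 : ENNReal))) h3 (by simp)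
  rw [tsub_zero] at h4
  refine tendsto_of_tendsto_of_tendsto_of_le_of_le h4 tendsto_const_nhds (fun n => ?_)
    fun n => prob_le_one
  rw [tsub_le_iff_right]
  calc (1 : ENNReal) = (ν n : Measure (V n → X)) Set.univ := by simp
    _ = (ν n : Measure (V n → X)) (goodModels U (σ n) ∪ (goodModels U (σ n))ᶜ) := by simp
    _ ≤ _ := measure_union_le _ _

end Empirical

/-! ### Independent copies of locally convergent measures -/

section Independent

variable {V : Type v} {W : Type w} [Fintype W] {X : Type z} [MeasurableSpace X]

lemma measurable_zip {I : Type w} {Y : Type z} [MeasurableSpace Y] :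
    Measurable fun (q : (I → Y) × (I → Y)) i => (q.1 i, q.2 i) :=
  measurable_pi_lambda _ fun i => ((measurable_pi_apply i).comp measurable_fst).prodMk
    ((measurable_pi_apply i).comp measurable_snd)

lemma coe_square {I : Type w} {Y : Type z} [MeasurableSpace Y] (μ : ProbabilityMeasure (I → Y)) :
    (square μ : Measure (I → Y × Y)) =
      ((μ : Measure (I → Y)).prod (μ : Measure (I → Y))).map fun q i => (q.1 i, q.2 i) := rfl

lemma square_iidPower (ν : ProbabilityMeasure (V → X)) :
    square (iidPower W ν) = iidPower W (square ν) := by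
  refine Subtype.ext ?_
  change (square (iidPower W ν) : Measure (V × W → X × X)) = iidPower W (square ν)
  rw [coe_square, coe_iidPower, coe_iidPower, Measure.map_prod_map _ _ measurable_uncurrySwap
    measurable_uncurrySwap, ← (measurePreserving_arrowProdEquivProdArrow (V → X) (V → X) W
    (fun _ => (ν : Measure (V → X))) (fun _ => (ν : Measure (V → X)))).map_eq,
    Measure.map_map measurable_zip (measurable_uncurrySwap.prodMap measurable_uncurrySwap),
    Measure.map_map (measurable_zip.comp (measurable_uncurrySwap.prodMap measurable_uncurrySwap))
      (MeasurableEquiv.measurable _)]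
  simp only [coe_square]
  have : ∀ _ : W, IsProbabilityMeasure (((ν : Measure (V → X)).prod (ν : Measure (V → X))).map
      fun (q : (V → X) × (V → X)) i => (q.1 i, q.2 i)) := fun _ =>
    Measure.isProbabilityMeasure_map measurable_zip.aemeasurable
  rw [← Measure.pi_map_pi fun _ => measurable_zip.aemeasurable,
    Measure.map_map measurable_uncurrySwap]
  · rfl
  · exact measurable_pi_lambda _ fun q => measurable_zip.comp (measurable_pi_apply q)

/-- Chebyshev's inequality for averages over independent samples. -/
lemma iidPower_deviation_le [Nonempty W] (ν : ProbabilityMeasure (V → X)) {g : (V → X) → ℝ}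
    (hg : Measurable g) {C : ℝ} (hC : ∀ x, |g x| ≤ C) {η : ℝ} (hη : 0 < η) :
    (iidPower W ν : Measure (V × W → X)) {x | η ≤ |(∑ q : W, g (slice q x)) / Fintype.card W -
      ∫ y, g y ∂(ν : Measure (V → X))|} ≤ ENNReal.ofReal (C ^ 2 / η ^ 2 / Fintype.card W) := by
  have hW : (0 : ℝ) < Fintype.card W := by positivity
  have hgL : MemLp g 2 (ν : Measure (V → X)) :=
    MemLp.of_bound hg.aestronglyMeasurable C (ae_of_all _ hC)
  have hgI : Integrable g (ν : Measure (V → X)) := hgL.integrable (by norm_num)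
  let Y : (W → V → X) → ℝ := ∑ q : W, fun x => g (x q)
  have hY : MemLp Y 2 (Measure.pi fun _ : W => (ν : Measure (V → X))) :=
    memLp_finsetSum' _ fun q _ => hgL.comp_measurePreserving (measurePreserving_eval _ q)
  have hYE : ∫ x, Y x ∂(Measure.pi fun _ : W => (ν : Measure (V → X))) =
      Fintype.card W * ∫ y, g y ∂(ν : Measure (V → X)) := by
    simp only [Y, Finset.sum_apply]
    have hI : ∀ q : W, Integrable (fun x : W → V → X => g (x q))
        (Measure.pi fun _ : W => (ν : Measure (V → X))) := fun q =>
      (measurePreserving_eval (fun _ : W => (ν : Measure (V → X))) q).integrable_comp_of_integrable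
        hgI
    rw [integral_finsetSum _ fun q _ => hI q]
    have : ∀ q : W, ∫ x, g (x q) ∂(Measure.pi fun _ : W => (ν : Measure (V → X))) =
        ∫ y, g y ∂(ν : Measure (V → X)) := fun q => by
      have h := integral_map (μ := Measure.pi fun _ : W => (ν : Measure (V → X)))
        (measurable_pi_apply q).aemeasurable hg.aestronglyMeasurable
      have he := (measurePreserving_eval (fun _ : W => (ν : Measure (V → X))) q).map_eq
      exact h.symm.trans (congrArg (fun m => ∫ y, g y ∂m) he)
    simp [this]
  have hvar : ProbabilityTheory.variance Y (Measure.pi fun _ : W => (ν : Measure (V → X))) ≤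
      Fintype.card W * C ^ 2 := by
    have h1 := ProbabilityTheory.variance_sum_pi (μ := fun _ : W => (ν : Measure (V → X)))
      (X := fun _ => g) fun _ => hgL
    have h2 : ProbabilityTheory.variance g (ν : Measure (V → X)) ≤ ((C - -C) / 2) ^ 2 :=
      ProbabilityTheory.variance_le_sq_of_bounded
        (ae_of_all _ fun x => ⟨(abs_le.1 (hC x)).1, (abs_le.1 (hC x)).2⟩) hg.aemeasurable
    rw [h1, Finset.sum_const, Finset.card_univ, nsmul_eq_mul]
    refine mul_le_mul_of_nonneg_left (h2.trans_eq ?_) hW.le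
    ring
  have hcheb := ProbabilityTheory.meas_ge_le_variance_div_sq hY (c := Fintype.card W * η)
    (by positivity)
  rw [coe_iidPower, Measure.map_apply measurable_uncurrySwap]
  · refine (le_trans (measure_mono ?_) hcheb).trans (ENNReal.ofReal_le_ofReal ?_)
    · intro x hx
      have hx' : η ≤ |(∑ q : W, g (x q)) / Fintype.card W - ∫ y, g y ∂(ν : Measure (V → X))| := hx
      change Fintype.card W * η ≤ |Y x - ∫ x, Y x ∂(Measure.pi fun _ : W => (ν : Measure (V → X)))|
      rw [hYE]
      have h3 : Y x - Fintype.card W * ∫ y, g y ∂(ν : Measure (V → X)) = Fintype.card W *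
          ((∑ q : W, g (x q)) / Fintype.card W - ∫ y, g y ∂(ν : Measure (V → X))) := by
        simp only [Y, Finset.sum_apply]
        field_simp
      rw [h3, abs_mul, abs_of_pos hW]
      exact mul_le_mul_of_nonneg_left hx' hW.le
    · refine (div_le_div_of_nonneg_right hvar (by positivity)).trans_eq ?_
      field_simp
  · refine measurableSet_le measurable_const (Measurable.abs ?_)
    exact ((Finset.measurable_sum _ fun q _ => hg.comp (measurable_slice q)).div_const _).sub_const
      _

end Independent

/-! ### Independent copies over the enlarged maps -/

section Enlarge

variable {G : Type u} {X : Type z} {V : ℕ → Type v} {W : ℕ → Type w}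
  [∀ n, Fintype (V n)] [∀ n, Nonempty (V n)] [∀ n, Fintype (W n)] [∀ n, Nonempty (W n)]
  {σ : ∀ n, G → Equiv.Perm (V n)}

lemma tendsto_densityFilter_fst : Tendsto
    (fun x : Σ n, V n × W n => (⟨x.1, x.2.1⟩ : Σ n, V n)) (densityFilter fun n => V n × W n)
    (densityFilter V) := by
  intro S hS
  rw [mem_densityFilter_iff] at hS
  refine mem_densityFilter_iff.2 (hS.congr fun n => ?_)
  have h : {p : V n × W n | (⟨n, p⟩ : Σ n, V n × W n) ∈
      (fun x : Σ n, V n × W n => (⟨x.1, x.2.1⟩ : Σ n, V n)) ⁻¹' S}ᶜ =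
      {p : V n | (⟨n, p⟩ : Σ n, V n) ∈ S}ᶜ ×ˢ Set.univ := by
    ext p
    simp
  have hW : (Fintype.card (W n) : ℝ) ≠ 0 := by positivity
  rw [h, Set.ncard_prod, Set.ncard_univ, Nat.card_eq_fintype_card, Fintype.card_prod]
  push_cast
  rw [mul_div_mul_right _ _ hW]

variable [MeasurableSpace X]

omit [∀ n, Fintype (V n)] [∀ n, Nonempty (V n)] [∀ n, Nonempty (W n)] in
-- The enlarged maps fix the second coordinate, so a pullback name reads a single slice, whose law
-- is `ν n`.
lemma localLaw_iidPower {ν : ∀ n, ProbabilityMeasure (V n → X)} (n : ℕ) (p : V n × W n) :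
    localLaw (enlarge σ W n) (iidPower (W n) (ν n)) p = localLaw (σ n) (ν n) p.1 := by
  refine Subtype.ext ?_
  change (iidPower (W n) (ν n) : Measure (V n × W n → X)).map (pullbackName (enlarge σ W n) p) =
    (ν n : Measure (V n → X)).map (pullbackName (σ n) p.1)
  rw [← map_slice_iidPower (ν n) p.2, Measure.map_map (measurable_pullbackName _ _)
    (measurable_slice _)]
  rfl

lemma localLaw_square {U : Type v} (s : G → Equiv.Perm U) (ν : ProbabilityMeasure (U → X))
    (p : U) : localLaw s (square ν) p = square (localLaw s ν p) := by
  refine Subtype.ext ?_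
  change (square ν : Measure (U → X × X)).map (pullbackName s p) =
    (((ν : Measure (U → X)).map (pullbackName s p)).prod
      ((ν : Measure (U → X)).map (pullbackName s p))).map fun q i => (q.1 i, q.2 i)
  rw [coe_square, Measure.map_prod_map _ _ (measurable_pullbackName s p)
    (measurable_pullbackName s p), Measure.map_map (measurable_pullbackName s p) measurable_zip,
    Measure.map_map measurable_zip
      ((measurable_pullbackName s p).prodMap (measurable_pullbackName s p))]
  rfl

variable [Countable G]

/-- An empirical integral over `V n × W n` is the mean of `|W n|` independent empirical integrals
over slices. Their common expectation is a vertex average of local integrals, which converges by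
local convergence, and the fluctuations vanish by Chebyshev's inequality. -/
lemma LWConverges.leConverges_iidPower [TopologicalSpace X] [SecondCountableTopology X]
    [BorelSpace X] {ν : ∀ n, ProbabilityMeasure (V n → X)} {μ : ProbabilityMeasure (G → X)}
    (hW : Tendsto (fun n => Fintype.card (W n)) atTop atTop) (h : LWConverges σ ν μ) :
    LEConverges (enlarge σ W) (fun n => iidPower (W n) (ν n)) μ := by
  refine ⟨?_, tendsto_goodModels_of_tendsto_integral fun f η hη => ?_⟩
  · rw [lwConverges_iff_tendsto]
    simp_rw [localLaw_iidPower]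
    exact (lwConverges_iff_tendsto.1 h).comp tendsto_densityFilter_fst
  · have hfm : Measurable f := f.continuous.measurable
    have hfC : ∀ x, |f x| ≤ ‖f‖ := f.norm_coe_le_norm
    let g : ∀ n, (V n → X) → ℝ := fun n y =>
      (∑ p, f (pullbackName (σ n) p y)) / Fintype.card (V n)
    have hgm : ∀ n, Measurable (g n) := fun n =>
      (Finset.measurable_sum _ fun p _ => hfm.comp (measurable_pullbackName (σ n) p)).div_const _
    have hgC : ∀ n y, |g n y| ≤ ‖f‖ := by
      intro n y
      have hV : (0 : ℝ) < Fintype.card (V n) := by positivity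
      rw [abs_div, abs_of_pos hV, div_le_iff₀ hV]
      refine (Finset.abs_sum_le_sum_abs _ _).trans
        ((Finset.sum_le_sum fun p _ => hfC _).trans_eq ?_)
      simp [mul_comm]
    have hgint : ∀ n, ∫ y, g n y ∂(ν n : Measure (V n → X)) =
        (∑ p, ∫ x, f x ∂(localLaw (σ n) (ν n) p : Measure (G → X))) / Fintype.card (V n) := by
      intro n
      simp only [g]
      rw [integral_div, integral_finsetSum]
      · simp_rw [integral_localLaw _ _ _ hfm]
      · exact fun p _ => Integrable.of_bound
          (hfm.comp (measurable_pullbackName (σ n) p)).aestronglyMeasurable ‖f‖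
          (ae_of_all _ fun x => hfC _)
    have hmean := h.tendsto_average_integral f
    simp_rw [← hgint] at hmean
    have hemp : ∀ n (x : V n × W n → X),
        ∫ y, f y ∂(empirical (enlarge σ W n) x : Measure (G → X)) =
        (∑ q : W n, g n (slice q x)) / Fintype.card (W n) := by
      intro n x
      rw [integral_empirical _ _ hfm, Fintype.card_prod, Fintype.sum_prod_type_right]
      simp only [g]
      rw [← Finset.sum_div, div_div]
      push_cast
      rfl
    have hlim : Tendsto (fun n => ENNReal.ofReal (‖f‖ ^ 2 / (η / 2) ^ 2 / Fintype.card (W n)))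
        atTop (𝓝 0) := by
      rw [← ENNReal.ofReal_zero]
      exact (ENNReal.continuous_ofReal.tendsto 0).comp
        (tendsto_const_nhds.div_atTop (tendsto_natCast_atTop_atTop.comp hW))
    refine tendsto_of_tendsto_of_tendsto_of_le_of_le' tendsto_const_nhds hlim
      (Eventually.of_forall fun n => zero_le) ?_
    filter_upwards [Metric.tendsto_nhds.1 hmean (η / 2) (by positivity)] with n hn
    refine le_trans (measure_mono ?_) (iidPower_deviation_le (ν n) (hgm n) (hgC n) (half_pos hη))
    intro x hx
    have hx' : η ≤ |∫ y, f y ∂(empirical (enlarge σ W n) x : Measure (G → X)) -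
        ∫ y, f y ∂(μ : Measure (G → X))| := hx
    rw [hemp] at hx'
    rw [Real.dist_eq] at hn
    have h3 := abs_sub_le ((∑ q : W n, g n (slice q x)) / Fintype.card (W n))
      (∫ y, g n y ∂(ν n : Measure (V n → X))) (∫ y, f y ∂(μ : Measure (G → X)))
    change η / 2 ≤ _
    linarith

lemma continuous_square {I : Type u} [Countable I] {Y : Type z} [MetricSpace Y]
    [SecondCountableTopology Y] [MeasurableSpace Y] [BorelSpace Y] :
    Continuous (square (I := I) (Y := Y)) := by
  have h1 : Continuous fun μ : ProbabilityMeasure (I → Y) => μ.prod μ :=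
    ProbabilityMeasure.continuous_prod.comp (continuous_id.prodMk continuous_id)
  have h2 : Continuous fun (q : (I → Y) × (I → Y)) i => (q.1 i, q.2 i) := by fun_prop
  exact (ProbabilityMeasure.continuous_map h2).comp h1

/-- Squaring commutes with independent powers and with local laws, and is weakly continuous, so the
single-copy result applies to the squared measures. -/
lemma LWConverges.ldeConverges_iidPower {Y : Type z} [MetricSpace Y] [SecondCountableTopology Y]
    [MeasurableSpace Y] [BorelSpace Y]
    {ν : ∀ n, ProbabilityMeasure (V n → Y)} {μ : ProbabilityMeasure (G → Y)}
    (hW : Tendsto (fun n => Fintype.card (W n)) atTop atTop) (h : LWConverges σ ν μ) :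
    LDEConverges (enlarge σ W) (fun n => iidPower (W n) (ν n)) μ := by
  have h1 : LWConverges σ (fun n => square (ν n)) (square μ) := by
    rw [lwConverges_iff_tendsto]
    simp_rw [localLaw_square]
    exact (continuous_square.tendsto μ).comp (lwConverges_iff_tendsto.1 h)
  unfold LDEConverges
  simp_rw [square_iidPower]
  exact h1.leConverges_iidPower hW

end Enlarge

/-! ### Covering numbers and conditioned measures -/

section Covering

variable {U : Type v} [Fintype U] {X : Type z} [MetricSpace X] [MeasurableSpace X]

/-- Nonemptiness of `F` is demanded because `Real.log 0 = 0` would otherwise hide an empty cover. -/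
lemma le_log_coveringNumber {ν : ProbabilityMeasure (U → X)} {ε δ a : ℝ}
    (h : ∀ F : Finset (U → X),
      1 - ε < (ν : Measure (U → X)).real (⋃ c ∈ F, {x | hammingAverage x c < δ}) →
        a ≤ Real.log F.card ∧ F.Nonempty) :
    (a : EReal) ≤ ENNReal.log (coveringNumber ν ε δ : ENNReal) := by
  have h1 : ((⌈Real.exp a⌉₊ : ℕ) : ℕ∞) ≤ coveringNumber ν ε δ := by
    refine le_iInf₂ fun F hF => Nat.cast_le.2 (Nat.ceil_le.2 ?_)
    obtain ⟨h2, h3⟩ := h F hF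
    exact (Real.le_log_iff_exp_le (by exact_mod_cast h3.card_pos)).1 h2
  have h2 : ENNReal.ofReal (Real.exp a) ≤ (coveringNumber ν ε δ : ENNReal) := by
    refine le_trans ?_ (ENat.toENNReal_mono h1)
    rw [ENat.toENNReal_coe, ← ENNReal.ofReal_natCast]
    exact ENNReal.ofReal_le_ofReal (Nat.le_ceil _)
  have h3 := ENNReal.log_monotone h2
  rwa [ENNReal.log_ofReal_of_pos (Real.exp_pos a), Real.log_exp] at h3

lemma coveringNumber_anti {ν : ProbabilityMeasure (U → X)} {ε ε' δ : ℝ} (h : ε ≤ ε') :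
    coveringNumber ν ε' δ ≤ coveringNumber ν ε δ :=
  le_iInf₂ fun F hF => iInf₂_le F (show 1 - ε' < (ν : Measure (U → X)).real _ from
    lt_of_le_of_lt (sub_le_sub_left h 1) hF)

variable [CompactSpace X]

lemma FinitePartition.hammingAverage_lt [Nonempty U] {P : FinitePartition X} {δ : ℝ}
    (hP : ∀ C ∈ P.cells, Metric.diam C < δ) {c : U → P.cells} {x y : U → X} (hx : x ∈ P.box c)
    (hy : y ∈ P.box c) : hammingAverage x y < δ := by
  have hU : (0 : ℝ) < Fintype.card U := by positivity
  rw [hammingAverage, div_lt_iff₀ hU]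
  have h : ∀ p ∈ Finset.univ, dist (x p) (y p) < δ := fun p _ =>
    (Metric.dist_le_diam_of_mem Metric.isBounded_of_compactSpace (hx p trivial)
      (hy p trivial)).trans_lt (hP _ (c p).2)
  refine (Finset.sum_lt_sum_of_nonempty Finset.univ_nonempty h).trans_eq ?_
  simp [mul_comm]

/-- Conditioning on the union of the light cells of `P ^ U` produces a measure whose entropy is
almost as large as the logarithm of the covering number. -/
lemma FinitePartition.exists_cond_entropy_ge [Nonempty U] [DecidableEq U]
    {P : FinitePartition X} {δ ε : ℝ}
    (hP : ∀ C ∈ P.cells, Metric.diam C < δ) (hε : 0 < ε) (hε1 : ε ≤ 1)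
    (ν : ProbabilityMeasure (U → X)) :
    ∃ (A : Set (U → X)) (ν' : ProbabilityMeasure (U → X)),
      MeasurableSet A ∧ ε ≤ (ν : Measure (U → X)).real A ∧
      (ν' : Measure (U → X)) = ProbabilityTheory.cond (ν : Measure (U → X)) A ∧
      ENNReal.log (coveringNumber ν ε δ : ENNReal) ≤
        (((P.power U).entropy ν' - Real.log ε : ℝ) : EReal) := by
  classical
  choose ctr hctr using fun c : U → P.cells => P.box_nonempty c
  have hsub : ∀ S : Finset (U → P.cells), ⋃ c ∈ S, P.box c ⊆
      ⋃ y ∈ S.image ctr, {x : U → X | hammingAverage x y < δ} := by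
    intro S
    refine Set.iUnion₂_subset fun c hc x hx => ?_
    exact Set.mem_biUnion (Finset.mem_image_of_mem ctr hc)
      (hammingAverage_lt hP hx (hctr c))
  have hcov : ∀ S : Finset (U → P.cells), 1 - ε < (ν : Measure (U → X)).real (⋃ c ∈ S, P.box c) →
      coveringNumber ν ε δ ≤ S.card := fun S hS =>
    (iInf₂_le (S.image ctr) (hS.trans_le (measureReal_mono (hsub S) (measure_ne_top _ _)))).trans
      (Nat.cast_le.2 Finset.card_image_le)
  have hreal : ∀ S : Finset (U → P.cells), (ν : Measure (U → X)).real (⋃ c ∈ S, P.box c) =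
      ∑ c ∈ S, (ν : Measure (U → X)).real (P.box c) := fun S =>
    measureReal_biUnion_finset (fun c _ c' _ hcc => Set.disjoint_left.2 fun x hx hx' =>
      hcc ((P.mem_box_iff.1 hx).symm.trans (P.mem_box_iff.1 hx'))) fun c _ => P.measurableSet_box c
  have hfin : coveringNumber ν ε δ ≠ ⊤ := by
    refine ne_top_of_le_ne_top (ENat.natCast_ne_top _) (hcov Finset.univ ?_)
    rw [hreal, P.sum_box]
    linarith
  obtain ⟨N, hN⟩ := ENat.ne_top_iff_exists.1 hfin
  have hN1 : 1 ≤ N := by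
    have : ((1 : ℕ) : ℕ∞) ≤ coveringNumber ν ε δ := by
      refine le_iInf₂ fun F hF => Nat.cast_le.2 (Finset.card_pos.2 ?_)
      by_contra h
      rw [Finset.not_nonempty_iff_eq_empty] at h
      subst h
      simp at hF
      linarith
    rw [← hN] at this
    exact_mod_cast this
  have hN0 : (0 : ℝ) < N := by exact_mod_cast hN1
  let L : Finset (U → P.cells) :=
    Finset.univ.filter fun c => (ν : Measure (U → X)).real (P.box c) ≤ 1 / N
  let A : Set (U → X) := ⋃ c ∈ L, P.box c
  have hAm : MeasurableSet A := Finset.measurableSet_biUnion _ fun c _ => P.measurableSet_box c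
  -- If the light cells had mass below `ε`, the heavy ones would give a cover of mass above `1 - ε`.
  -- There are fewer than `N` of them, as each has mass above `1 / N`, contradicting minimality of
  -- `N`.
  have hA : ε ≤ (ν : Measure (U → X)).real A := by
    by_contra! hlt
    have hsplit := Finset.sum_add_sum_compl L fun c => (ν : Measure (U → X)).real (P.box c)
    rw [P.sum_box, ← hreal L] at hsplit
    have hheavy : 1 - ε < ∑ c ∈ Lᶜ, (ν : Measure (U → X)).real (P.box c) := by
      change (ν : Measure (U → X)).real A + _ = 1 at hsplit
      linarith
    have hne : (Lᶜ).Nonempty := by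
      by_contra h
      rw [Finset.not_nonempty_iff_eq_empty] at h
      rw [h, Finset.sum_empty] at hheavy
      linarith
    have h1 := hcov Lᶜ (by rwa [hreal])
    rw [← hN, Nat.cast_le] at h1
    have h2 : ∑ _c ∈ Lᶜ, (1 / N : ℝ) < ∑ c ∈ Lᶜ, (ν : Measure (U → X)).real (P.box c) :=
      Finset.sum_lt_sum_of_nonempty hne fun c hc => by
        simpa [L] using hc
    have h3 : 0 ≤ (ν : Measure (U → X)).real A := measureReal_nonneg
    change (ν : Measure (U → X)).real A + _ = 1 at hsplit
    have h4 : ((Lᶜ).card : ℝ) * (1 / N) < 1 := by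
      rw [Finset.sum_const, nsmul_eq_mul] at h2
      linarith
    rw [mul_one_div, div_lt_one hN0] at h4
    have : (Lᶜ).card < N := by exact_mod_cast h4
    omega
  have hA0 : (ν : Measure (U → X)) A ≠ 0 := by
    intro h0
    rw [measureReal_def, h0, ENNReal.toReal_zero] at hA
    linarith
  let ν' : ProbabilityMeasure (U → X) := ⟨ProbabilityTheory.cond (ν : Measure (U → X)) A,
    ProbabilityTheory.cond_isProbabilityMeasure hA0⟩
  have hν' : (ν' : Measure (U → X)) = ProbabilityTheory.cond (ν : Measure (U → X)) A := rfl
  refine ⟨A, ν', hAm, hA, hν', ?_⟩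
  -- Conditioning raises the mass of a light cell by a factor of at most `1 / ε`; this uniform bound
  -- forces entropy at least `log (N * ε)`.
  have hbox : ∀ c, (ν' : Measure (U → X)).real (P.box c) ≤ 1 / (N * ε) := by
    intro c
    have hpos : 0 < (ν : Measure (U → X)).real A := hε.trans_le hA
    rw [hν', measureReal_def, ProbabilityTheory.cond_apply hAm, ENNReal.toReal_mul,
      ENNReal.toReal_inv, ← measureReal_def, ← measureReal_def, inv_mul_eq_div]
    by_cases hc : c ∈ L
    · have h1 : (ν : Measure (U → X)).real (P.box c) ≤ 1 / N := by simpa [L] using hc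
      rw [← div_div]
      exact div_le_div₀ (by positivity) ((measureReal_mono Set.inter_subset_right).trans h1) hε hA
    · have : A ∩ P.box c = ∅ := by
        refine Set.eq_empty_iff_forall_notMem.2 fun x hx => ?_
        obtain ⟨d, hd, hxd⟩ := Set.mem_iUnion₂.1 hx.1
        exact hc ((P.mem_box_iff.1 hxd).symm.trans (P.mem_box_iff.1 hx.2) ▸ hd)
      rw [this, measureReal_empty, zero_div]
      positivity
  have hent : Real.log (N * ε) ≤ (P.power U).entropy ν' := by
    rw [P.entropy_power]
    calc Real.log (N * ε) =
        ∑ c, (ν' : Measure (U → X)).real (P.box c) * Real.log (N * ε) := by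
          rw [← Finset.sum_mul, P.sum_box, one_mul]
      _ ≤ _ := Finset.sum_le_sum fun c _ => by
          rcases (measureReal_nonneg (μ := (ν' : Measure (U → X))) (s := P.box c)).eq_or_lt with
            h | h
          · simp [← h]
          · rw [Real.negMulLog, neg_mul_comm]
            refine mul_le_mul_of_nonneg_left ?_ h.le
            have h1 := Real.log_le_log h (hbox c)
            rw [one_div, Real.log_inv] at h1
            linarith
  rw [Real.log_mul hN0.ne' hε.ne'] at hent
  rw [← hN, ENat.toENNReal_coe, ← ENNReal.ofReal_natCast, ENNReal.log_ofReal_of_pos hN0]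
  exact EReal.coe_le_coe_iff.2 (by linarith)

end Covering

/-! ### Local convergence after conditioning and slice averaging -/

section Conditioning

variable {G : Type u} [Countable G] {V : ℕ → Type v} [∀ n, Fintype (V n)] [∀ n, Nonempty (V n)]
  {X : Type z} [TopologicalSpace X] [SecondCountableTopology X] [MeasurableSpace X] [BorelSpace X]
  {σ : ∀ n, G → Equiv.Perm (V n)} {ν ν' : ∀ n, ProbabilityMeasure (V n → X)}
  {μ : ProbabilityMeasure (G → X)}

lemma cond_le_smul {Ω : Type*} [MeasurableSpace Ω] (m : Measure Ω) [IsFiniteMeasure m] {A : Set Ω}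
    {ε : ℝ} (hA : ε ≤ m.real A) :
    ProbabilityTheory.cond m A ≤ (ENNReal.ofReal ε)⁻¹ • m := by
  have h : ENNReal.ofReal ε ≤ m A := ENNReal.ofReal_le_of_le_toReal hA
  refine Measure.le_iff.2 fun s hs => ?_
  rw [ProbabilityTheory.cond, Measure.smul_apply, Measure.smul_apply, smul_eq_mul, smul_eq_mul]
  exact mul_le_mul' (ENNReal.inv_le_inv.2 h) (Measure.restrict_apply_le A s)

/-- The product of two copies of a function. -/
def tensorSquare {Y : Type z} [TopologicalSpace Y]
    (F : BoundedContinuousFunction (G → Y) ℝ) : BoundedContinuousFunction (G → Y × Y) ℝ :=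
  BoundedContinuousFunction.ofNormedAddCommGroup
    (fun z => F (fun g => (z g).1) * F (fun g => (z g).2))
    ((F.continuous.comp (by fun_prop)).mul (F.continuous.comp (by fun_prop))) (‖F‖ * ‖F‖)
    fun z => by
      rw [norm_mul]
      exact mul_le_mul (F.norm_coe_le_norm _) (F.norm_coe_le_norm _) (norm_nonneg _) (norm_nonneg _)

omit [Countable G] [SecondCountableTopology X] [MeasurableSpace X] [BorelSpace X] in
lemma tensorSquare_apply (F : BoundedContinuousFunction (G → X) ℝ) (z : G → X × X) :
    tensorSquare F z = F (fun g => (z g).1) * F (fun g => (z g).2) := rfl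

lemma integral_tensorSquare (F : BoundedContinuousFunction (G → X) ℝ) :
    ∫ z, tensorSquare F z ∂(square μ : Measure (G → X × X)) =
      (∫ x, F x ∂(μ : Measure (G → X))) ^ 2 := by
  rw [coe_square, integral_map measurable_zip.aemeasurable
    (tensorSquare F).continuous.measurable.aestronglyMeasurable]
  simp only [tensorSquare_apply]
  rw [integral_prod_mul (fun x => F x) fun x => F x, sq]

/-- Conditioning on events of non-vanishing probability preserves the convergence of local
averages under doubly empirical convergence. -/
lemma LDEConverges.tendsto_average_sq_cond (h : LDEConverges σ ν μ) {A : ∀ n, Set (V n → X)}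
    {ε : ℝ} (hε : 0 < ε) (hA : ∀ n, ε ≤ (ν n : Measure (V n → X)).real (A n))
    (hν' : ∀ n, (ν' n : Measure (V n → X)) =
      ProbabilityTheory.cond (ν n : Measure (V n → X)) (A n))
    (f : BoundedContinuousFunction (G → X) ℝ) :
    Tendsto (fun n => (∑ p, (∫ x, f x ∂(localLaw (σ n) (ν' n) p : Measure (G → X)) -
      ∫ x, f x ∂(μ : Measure (G → X))) ^ 2) / Fintype.card (V n)) atTop (𝓝 0) := by
  -- Centring `f` makes the integral of `tensorSquare F` against `square μ` vanish.
  let F : BoundedContinuousFunction (G → X) ℝ :=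
    f - BoundedContinuousFunction.const _ (∫ x, f x ∂(μ : Measure (G → X)))
  have hfm : Measurable f := f.continuous.measurable
  have hFm : Measurable F := F.continuous.measurable
  have hFC : ∀ x, ‖F x‖ ≤ ‖F‖ := F.norm_coe_le_norm
  have hF : ∀ ρ : ProbabilityMeasure (G → X), ∫ x, F x ∂(ρ : Measure (G → X)) =
      ∫ x, f x ∂(ρ : Measure (G → X)) - ∫ x, f x ∂(μ : Measure (G → X)) := fun ρ => by
    simp only [F, BoundedContinuousFunction.sub_apply, BoundedContinuousFunction.const_apply]
    rw [integral_sub (f.integrable _) (integrable_const _)]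
    simp
  have hTm : Measurable (tensorSquare F) := (tensorSquare F).continuous.measurable
  let Ψ : ∀ n, (V n → X × X) → ℝ := fun n z =>
    ∫ y, tensorSquare F y ∂(empirical (σ n) z : Measure (G → X × X))
  have hΨ : ∀ n z, Ψ n z = (∑ p, tensorSquare F (pullbackName (σ n) p z)) / Fintype.card (V n) :=
    fun n z => integral_empirical _ _ hTm
  have hΨm : ∀ n, Measurable (Ψ n) := fun n => by
    have : Ψ n = fun z => (∑ p, tensorSquare F (pullbackName (σ n) p z)) / Fintype.card (V n) :=
      funext (hΨ n)
    rw [this]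
    exact (Finset.measurable_sum _ fun p _ =>
      hTm.comp (measurable_pullbackName (σ n) p)).div_const _
  have hΨC : ∀ n z, |Ψ n z| ≤ ‖tensorSquare F‖ := fun n z =>
    (tensorSquare F).norm_integral_le_norm _
  -- The square of an integral is an integral over two independent copies; this is where the doubled
  -- process enters.
  have havg : ∀ n, (∑ p, (∫ x, f x ∂(localLaw (σ n) (ν' n) p : Measure (G → X)) -
      ∫ x, f x ∂(μ : Measure (G → X))) ^ 2) / Fintype.card (V n) =
      ∫ z, Ψ n z ∂(square (ν' n) : Measure (V n → X × X)) := by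
    intro n
    simp_rw [hΨ n]
    rw [integral_div, integral_finsetSum]
    · congr 1
      refine Finset.sum_congr rfl fun p _ => ?_
      rw [← integral_localLaw _ _ _ hTm, localLaw_square, integral_tensorSquare, hF]
    · exact fun p _ => Integrable.of_bound
        (hTm.comp (measurable_pullbackName (σ n) p)).aestronglyMeasurable ‖tensorSquare F‖
        (ae_of_all _ fun x => (tensorSquare F).norm_coe_le_norm _)
  simp_rw [havg]
  -- Conditioning costs a factor of at most `1 / ε` in each copy, so events negligible for `ν n × ν
  -- n` stay negligible.
  have hsq : ∀ n (B : Set (V n → X × X)), MeasurableSet B →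
      (square (ν' n) : Measure (V n → X × X)) B ≤
        (ENNReal.ofReal ε)⁻¹ * (ENNReal.ofReal ε)⁻¹ *
          (square (ν n) : Measure (V n → X × X)) B := by
    intro n B hB
    have h1 := cond_le_smul (ν n : Measure (V n → X)) (hA n)
    rw [← hν' n] at h1
    rw [coe_square, coe_square, Measure.map_apply measurable_zip hB,
      Measure.map_apply measurable_zip hB]
    have h2 : (ν' n : Measure (V n → X)).prod (ν' n : Measure (V n → X)) ≤
        ((ENNReal.ofReal ε)⁻¹ • (ν n : Measure (V n → X))).prod
          ((ENNReal.ofReal ε)⁻¹ • (ν n : Measure (V n → X))) := Measure.prod_mono h1 h1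
    refine (h2 _).trans_eq ?_
    rw [Measure.prod_smul_left, Measure.prod_smul_right, smul_smul, Measure.smul_apply,
      smul_eq_mul]
  rw [Metric.tendsto_nhds]
  intro η hη
  let U : Set (ProbabilityMeasure (G → X × X)) :=
    {ρ | |∫ y, tensorSquare F y ∂(ρ : Measure (G → X × X))| < η / 2}
  have hU : U ∈ 𝓝 (square μ) := by
    have hcont : Continuous fun ρ : ProbabilityMeasure (G → X × X) =>
        |∫ y, tensorSquare F y ∂(ρ : Measure (G → X × X))| :=
      (ProbabilityMeasure.continuous_integral_boundedContinuousFunction _).abs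
    refine (isOpen_lt hcont continuous_const).mem_nhds ?_
    change |∫ y, tensorSquare F y ∂(square μ : Measure (G → X × X))| < η / 2
    rw [integral_tensorSquare, hF]
    simpa using hη
  have hgood := h.2 U hU
  have hBm : ∀ n, MeasurableSet (goodModels U (σ n)) := fun n =>
    measurableSet_lt (hΨm n).abs measurable_const
  have hbad : Tendsto (fun n => (ENNReal.ofReal ε)⁻¹ * (ENNReal.ofReal ε)⁻¹ *
      (square (ν n) : Measure (V n → X × X)) (goodModels U (σ n))ᶜ) atTop (𝓝 0) := by
    have h1 : Tendsto (fun n => (square (ν n) : Measure (V n → X × X)) (goodModels U (σ n))ᶜ)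
        atTop (𝓝 0) := by
      have h2 := ENNReal.Tendsto.sub (tendsto_const_nhds (x := (1 : ENNReal))) hgood (by simp)
      rw [tsub_self] at h2
      exact h2.congr fun n => (prob_compl_eq_one_sub (hBm n)).symm
    have hne : (ENNReal.ofReal ε)⁻¹ * (ENNReal.ofReal ε)⁻¹ ≠ ⊤ := by
      have : (ENNReal.ofReal ε)⁻¹ ≠ ⊤ := ENNReal.inv_ne_top.2 (by simpa using hε)
      exact ENNReal.mul_ne_top this this
    simpa using ENNReal.Tendsto.const_mul h1 (Or.inr hne)
  have hη' : 0 < η / 4 / (‖tensorSquare F‖ + 1) := by positivity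
  filter_upwards [hbad.eventually (gt_mem_nhds (ENNReal.ofReal_pos.2 hη'))] with n hn
  have h3 : (square (ν' n) : Measure (V n → X × X)).real (goodModels U (σ n))ᶜ <
      η / 4 / (‖tensorSquare F‖ + 1) := by
    have h4 := (hsq n _ (hBm n).compl).trans_lt hn
    have h5 := ENNReal.toReal_strict_mono ENNReal.ofReal_ne_top h4
    rwa [ENNReal.toReal_ofReal hη'.le] at h5
  have h6 : ∀ z, |Ψ n z| ≤ η / 2 + (goodModels U (σ n))ᶜ.indicator
      (fun _ => ‖tensorSquare F‖) z := by
    intro z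
    by_cases hz : z ∈ goodModels U (σ n)
    · rw [Set.indicator_of_notMem (by simpa), add_zero]
      exact le_of_lt hz
    · rw [Set.indicator_of_mem (by simpa)]
      linarith [hΨC n z]
  have h7 : |∫ z, Ψ n z ∂(square (ν' n) : Measure (V n → X × X))| ≤ η / 2 +
      (square (ν' n) : Measure (V n → X × X)).real (goodModels U (σ n))ᶜ * ‖tensorSquare F‖ := by
    have hi := (integrable_const (μ := (square (ν' n) : Measure (V n → X × X)))
      ‖tensorSquare F‖).indicator (hBm n).compl
    refine (abs_integral_le_integral_abs).trans ((integral_mono ?_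
      ((integrable_const (η / 2)).add hi) h6).trans_eq ?_)
    · exact (Integrable.of_bound (hΨm n).aestronglyMeasurable ‖tensorSquare F‖
        (ae_of_all _ (hΨC n))).abs
    · simp only [Pi.add_apply]
      rw [integral_add (integrable_const _) hi, integral_indicator_const _ (hBm n).compl]
      simp
  rw [Real.dist_eq, sub_zero]
  refine h7.trans_lt ?_
  have h8 : (square (ν' n) : Measure (V n → X × X)).real (goodModels U (σ n))ᶜ *
      ‖tensorSquare F‖ ≤ η / 4 / (‖tensorSquare F‖ + 1) * (‖tensorSquare F‖ + 1) :=
    mul_le_mul h3.le (by linarith) (norm_nonneg _) hη'.le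
  rw [div_mul_cancel₀ _ (by positivity)] at h8
  linarith

variable {W : ℕ → Type w} [∀ n, Fintype (W n)] [∀ n, Nonempty (W n)]

/-- The local integral of the slice average at `p` is the mean over `q` of those at `(p, q)`, and
the square of a mean is at most the mean of the squares. -/
lemma lwConverges_sliceAverage {ν' : ∀ n, ProbabilityMeasure (V n × W n → X)}
    (h : ∀ f : BoundedContinuousFunction (G → X) ℝ, Tendsto (fun n => (∑ p,
      (∫ x, f x ∂(localLaw (enlarge σ W n) (ν' n) p : Measure (G → X)) -
        ∫ x, f x ∂(μ : Measure (G → X))) ^ 2) / Fintype.card (V n × W n)) atTop (𝓝 0)) :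
    LWConverges σ (fun n => sliceAverage (ν' n)) μ := by
  refine lwConverges_of_tendsto_average_sq fun f => ?_
  refine squeeze_zero (fun n => div_nonneg (Finset.sum_nonneg fun p _ => sq_nonneg _)
    (Nat.cast_nonneg _)) (fun n => ?_) (h f)
  have hfm : Measurable f := f.continuous.measurable
  have hW : (0 : ℝ) < Fintype.card (W n) := by positivity
  rw [Fintype.card_prod, Nat.cast_mul, mul_comm, ← div_div, Fintype.sum_prod_type,
    Finset.sum_div _ _ (Fintype.card (W n) : ℝ)]
  refine div_le_div_of_nonneg_right (Finset.sum_le_sum fun p _ => ?_) (Nat.cast_nonneg _)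
  have h1 : ∫ x, f x ∂(localLaw (σ n) (sliceAverage (ν' n)) p : Measure (G → X)) -
      ∫ x, f x ∂(μ : Measure (G → X)) = (∑ q : W n,
        (∫ x, f x ∂(localLaw (enlarge σ W n) (ν' n) (p, q) : Measure (G → X)) -
          ∫ x, f x ∂(μ : Measure (G → X)))) / Fintype.card (W n) := by
    rw [integral_localLaw _ _ _ hfm, integral_sliceAverage _
      (f := fun x => f (pullbackName (σ n) p x))
      (hfm.comp (measurable_pullbackName (σ n) p)) fun x => f.norm_coe_le_norm _,
      Finset.sum_sub_distrib, sub_div]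
    simp_rw [integral_localLaw _ _ _ hfm]
    simp
    rfl
  rw [h1, div_pow, div_le_div_iff₀ (by positivity) hW]
  have h2 := sq_sum_le_card_mul_sum_sq (s := (Finset.univ : Finset (W n)))
    (f := fun q => ∫ x, f x ∂(localLaw (enlarge σ W n) (ν' n) (p, q) : Measure (G → X)) -
          ∫ x, f x ∂(μ : Measure (G → X)))
  rw [Finset.card_univ] at h2
  nlinarith [mul_le_mul_of_nonneg_right h2 hW.le]

end Conditioning

/-! ### Comparison of the two entropies -/

section Comparison

/-- The comparison sequence may depend on `η`, as the covering parameters do in the application. -/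
lemma limsup_le_of_eventually_le_add {a : ℕ → EReal} {M : EReal}
    (h : ∀ η : ℝ, 0 < η → ∃ b : ℕ → EReal, (∀ᶠ i in atTop, a i ≤ b i + η) ∧ limsup b atTop ≤ M) :
    limsup a atTop ≤ M := by
  refine le_of_forall_gt fun c hc => ?_
  obtain ⟨r, hMr, hrc⟩ := EReal.lt_iff_exists_real_btwn.1 hc
  obtain ⟨s, hrs, hsc⟩ := EReal.lt_iff_exists_real_btwn.1 hrc
  have hrs' : r < s := EReal.coe_lt_coe_iff.1 hrs
  refine lt_of_le_of_lt (limsup_le_of_le (h := ?_)) hsc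
  obtain ⟨b, hab, hb⟩ := h (s - r) (sub_pos.2 hrs')
  filter_upwards [eventually_lt_of_limsup_lt (hb.trans_lt hMr), hab] with i h1 h2
  refine h2.trans ((add_le_add h1.le le_rfl).trans_eq ?_)
  rw [← EReal.coe_add]
  congr 1
  ring

lemma EReal_coe_div_natCast (a : ℝ) (n : ℕ) :
    (a : EReal) / (n : EReal) = ((a / n : ℝ) : EReal) := by
  rw [EReal.coe_div]
  rfl

/-- The permutation `s 1` need not be the identity, but it only reindexes the sum over vertices. -/
lemma sum_real_localLaw_one {G : Type u} [Group G] {X : Type z} [MeasurableSpace X] {U : Type v} [Fintype U] (s : G → Equiv.Perm U)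
    (ν : ProbabilityMeasure (U → X)) {B : Set X} (hB : MeasurableSet B) :
    ∑ p, (localLaw s ν p : Measure (G → X)).real ((fun x => x 1) ⁻¹' B) =
      ∑ p, (ν : Measure (U → X)).real {x | x p ∈ B} := by
  rw [← Equiv.sum_comp (s 1) fun p => (ν : Measure (U → X)).real {x | x p ∈ B}]
  exact Finset.sum_congr rfl fun p _ => by rw [real_localLaw _ _ _ (measurable_pi_apply 1 hB)]; rfl

lemma sum_real_iidPower {X : Type z} [MeasurableSpace X] {U : Type v} {Q : Type w} [Fintype U] [Fintype Q]
    (ν : ProbabilityMeasure (U → X)) {B : Set X} (hB : MeasurableSet B) :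
    ∑ p, (iidPower Q ν : Measure (U × Q → X)).real {x | x p ∈ B} =
      Fintype.card Q * ∑ p, (ν : Measure (U → X)).real {x | x p ∈ B} := by
  rw [Fintype.sum_prod_type_right]
  have h : ∀ q : Q, ∑ p : U, (iidPower Q ν : Measure (U × Q → X)).real {x | x (p, q) ∈ B} =
      ∑ p, (ν : Measure (U → X)).real {x | x p ∈ B} := fun q => by
    refine Finset.sum_congr rfl fun p _ => ?_
    conv_rhs => rw [← map_slice_iidPower ν q]
    exact (map_measureReal_apply (measurable_slice q) (measurable_pi_apply p hB)).symm
  rw [Finset.sum_congr rfl fun q _ => h q, Finset.sum_const, Finset.card_univ, nsmul_eq_mul]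

lemma exists_mul_log_div_lt (k : ℕ) {η : ℝ} (hη : 0 < η) :
    ∃ t : ℝ, 0 < t ∧ t < 1 ∧ -Real.log (1 - t) < η ∧ t * Real.log (k / t) < η := by
  have h1 : Tendsto (fun t : ℝ => -Real.log (1 - t)) (𝓝[>] 0) (𝓝 0) := by
    have : ContinuousAt (fun t : ℝ => -Real.log (1 - t)) 0 :=
      (ContinuousAt.log (by fun_prop) (by norm_num)).neg
    have h := this.tendsto
    simp only [sub_zero, Real.log_one, neg_zero] at h
    exact h.mono_left nhdsWithin_le_nhds
  have h2 : Tendsto (fun t : ℝ => t * Real.log k + Real.negMulLog t) (𝓝[>] 0) (𝓝 0) := by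
    have : Continuous (fun t : ℝ => t * Real.log k + Real.negMulLog t) := by fun_prop
    have h := this.tendsto 0
    simp only [zero_mul, Real.negMulLog_zero, add_zero] at h
    exact h.mono_left nhdsWithin_le_nhds
  obtain ⟨t, ⟨h3, h4⟩, h5, h6⟩ := (((h1.eventually (gt_mem_nhds hη)).and
    (h2.eventually (gt_mem_nhds hη))).and (Ioo_mem_nhdsGT one_pos)).exists
  refine ⟨t, h5, h6, h3, ?_⟩
  rcases Nat.eq_zero_or_pos k with rfl | hk
  · simpa using hη
  · rw [Real.log_div (by positivity) h5.ne']
    rw [Real.negMulLog] at h4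
    linarith

variable {G : Type u} [Group G] [Countable G]
  {V : ℕ → Type v} [∀ n, Fintype (V n)] [∀ n, Nonempty (V n)]
  {W : ℕ → Type w} [∀ n, Fintype (W n)] [∀ n, Nonempty (W n)]
  {X : Type z} [MetricSpace X] [CompactSpace X] [MeasurableSpace X] [BorelSpace X]
  {σ : ∀ n, G → Equiv.Perm (V n)} {μ : ProbabilityMeasure (G → X)}

/-- Independent copies of locally convergent measures have large covering numbers. -/
lemma LWConverges.exists_entropy_le_log_coveringNumber {ν : ∀ n, ProbabilityMeasure (V n → X)}
    (h : LWConverges σ ν μ) (P : FinitePartition X)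
    (hP : ∀ C ∈ P.cells, (μ : Measure (G → X)) {x | x 1 ∈ frontier C} = 0) {η : ℝ} (hη : 0 < η) :
    ∃ ε δ : ℝ, 0 < ε ∧ 0 < δ ∧ ∀ᶠ n in atTop,
      (((P.power (V n)).entropy (ν n) / Fintype.card (V n) : ℝ) : EReal) ≤
        ENNReal.log (coveringNumber (iidPower (W n) (ν n)) ε δ : ENNReal) /
          Fintype.card (V n × W n) + η := by
  classical
  -- One half of `η` pays for the fixed channel cost, the other for a proportion of mismatches of at
  -- most `t`.
  obtain ⟨t, ht, ht1, hlog, hmul⟩ := exists_mul_log_div_lt P.cells.card (half_pos hη)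
  obtain ⟨r, hr, hμr⟩ := P.exists_boundaryNhd_real_lt (μ : Measure (G → X))
    (π := fun x => x 1) (measurable_pi_apply 1) hP (show 0 < t / 8 by positivity)
  have hB := (P.isClosed_boundaryNhd r).measurableSet
  -- The mismatch budget is `t / 4` from `δ / r`, `t / 4` from `ε`, and `t / 8 + t / 8` from the
  -- boundary. The bound `1 / 2` rules out the empty cover.
  refine ⟨min (t / 4) (1 / 2), t * r / 4, by positivity, by positivity, ?_⟩
  filter_upwards [h.eventually_average_real_le
    ((P.isClosed_boundaryNhd r).preimage (continuous_apply (1 : G)))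
    (show 0 < t / 8 by positivity)] with n hn
  have hV : (0 : ℝ) < Fintype.card (V n) := by positivity
  have hW : (0 : ℝ) < Fintype.card (W n) := by positivity
  have hcard : (Fintype.card (V n × W n) : ℝ) = Fintype.card (V n) * Fintype.card (W n) := by
    rw [Fintype.card_prod]; push_cast; rfl
  rw [sum_real_localLaw_one _ _ hB, div_le_iff₀ hV] at hn
  have hk : 0 ≤ Real.log (P.cells.card / t) := by
    obtain ⟨x⟩ := (ν n).nonempty
    have : Nonempty P.cells := ⟨P.label (x (Classical.arbitrary (V n)))⟩
    have h := log_card_div_nonneg (α := P.cells) ht ht1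
    rwa [Fintype.card_coe] at h
  have key : (((Fintype.card (W n) * (P.power (V n)).entropy (ν n) -
      Fintype.card (V n × W n) * η : ℝ)) : EReal) ≤
      ENNReal.log (coveringNumber (iidPower (W n) (ν n)) (min (t / 4) (1 / 2)) (t * r / 4) :
        ENNReal) := by
    refine le_log_coveringNumber fun F hF => ?_
    have hFne : F.Nonempty := by
      by_contra hne
      rw [Finset.not_nonempty_iff_eq_empty] at hne
      subst hne
      have h2 : min (t / 4) (1 / 2) ≤ 1 / 2 := min_le_right _ _
      simp only [Finset.notMem_empty, Set.iUnion_of_empty, Set.iUnion_empty,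
        measureReal_empty] at hF
      linarith
    refine ⟨?_, hFne⟩
    have hent := P.entropy_power_le_of_cover (iidPower (W n) (ν n)) hFne
      (show 0 < t * r / 4 by positivity) hr ht ht1 hB (fun x y hxy => P.mem_boundaryNhd hxy) hF
    rw [P.entropy_power_iidPower, sum_real_iidPower _ hB] at hent
    have h1 : t * r / 4 / r = t / 4 := by field_simp
    rw [h1] at hent
    have h2 : min (t / 4) (1 / 2) ≤ t / 4 := min_le_left _ _
    have h3 : Fintype.card (V n × W n) * (t / 4 + min (t / 4) (1 / 2)) +
        Fintype.card (W n) * ∑ p, (ν n : Measure (V n → X)).real {x | x p ∈ P.boundaryNhd r} ≤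
        Fintype.card (V n × W n) * t := by
      have h4 : Fintype.card (W n) * ∑ p, (ν n : Measure (V n → X)).real
          {x | x p ∈ P.boundaryNhd r} ≤ Fintype.card (W n) * (t / 4 * Fintype.card (V n)) := by
        refine mul_le_mul_of_nonneg_left (hn.trans ?_) hW.le
        exact mul_le_mul_of_nonneg_right (by linarith) hV.le
      have h5 : (Fintype.card (V n × W n) : ℝ) * (t / 4 + min (t / 4) (1 / 2)) ≤
          Fintype.card (V n × W n) * (t / 4 + t / 4) :=
        mul_le_mul_of_nonneg_left (by linarith) (by positivity)
      rw [hcard] at h5 ⊢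
      have h6 : (0 : ℝ) < Fintype.card (V n) * Fintype.card (W n) * t := by positivity
      nlinarith
    have h7 := mul_le_mul_of_nonneg_left h3 hk
    have h8 : Real.log (P.cells.card / t) * (Fintype.card (V n × W n) * t) ≤
        Fintype.card (V n × W n) * (η / 2) := by
      rw [mul_left_comm, mul_comm (Real.log _)]
      exact mul_le_mul_of_nonneg_left hmul.le (by positivity)
    have h9 : (Fintype.card (V n × W n) : ℝ) * -Real.log (1 - t) ≤
        Fintype.card (V n × W n) * (η / 2) :=
      mul_le_mul_of_nonneg_left hlog.le (by positivity)
    linarith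
  have hpos : (0 : EReal) ≤ (Fintype.card (V n × W n) : EReal) := by exact_mod_cast Nat.zero_le _
  have hdiv := EReal.div_le_div_right_of_nonneg hpos key
  rw [EReal_coe_div_natCast] at hdiv
  refine le_trans ?_ (add_le_add hdiv le_rfl)
  rw [← EReal.coe_add, EReal.coe_le_coe_iff, hcard]
  apply le_of_eq
  field_simp
  ring

omit [Group G] in
/-- Doubly empirically convergent measures over the enlarged maps give rise to locally convergent
measures of large entropy. -/
lemma LDEConverges.exists_lwConverges_entropy_ge {ν : ∀ n, ProbabilityMeasure (V n × W n → X)}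
    (h : LDEConverges (enlarge σ W) ν μ) {P : FinitePartition X} {δ ε : ℝ}
    (hP : ∀ C ∈ P.cells, Metric.diam C < δ) (hε : 0 < ε) (hε1 : ε ≤ 1) :
    ∃ ν' : ∀ n, ProbabilityMeasure (V n → X), LWConverges σ ν' μ ∧
      ∀ n, ENNReal.log (coveringNumber (ν n) ε δ : ENNReal) / Fintype.card (V n × W n) ≤
        (((P.power (V n)).entropy (ν' n) / Fintype.card (V n) : ℝ) : EReal) +
          ((-Real.log ε / Fintype.card (V n × W n) : ℝ) : EReal) := by
  classical
  choose A ρ hAm hA hρ hlog using fun n => P.exists_cond_entropy_ge hP hε hε1 (ν n)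
  refine ⟨fun n => sliceAverage (ρ n),
    lwConverges_sliceAverage (h.tendsto_average_sq_cond hε hA hρ), fun n => ?_⟩
  have hV : (0 : ℝ) < Fintype.card (V n) := by positivity
  have hW : (0 : ℝ) < Fintype.card (W n) := by positivity
  have hcard : (Fintype.card (V n × W n) : ℝ) = Fintype.card (V n) * Fintype.card (W n) := by
    rw [Fintype.card_prod]; push_cast; rfl
  have hpos : (0 : EReal) ≤ (Fintype.card (V n × W n) : EReal) := by exact_mod_cast Nat.zero_le _
  refine (EReal.div_le_div_right_of_nonneg hpos (hlog n)).trans ?_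
  rw [EReal_coe_div_natCast, ← EReal.coe_add, EReal.coe_le_coe_iff]
  have h1 := P.entropy_power_prod_le (ρ n)
  have h2 : (P.power (V n)).entropy (sliceAverage (ρ n)) / Fintype.card (V n) =
      Fintype.card (W n) * (P.power (V n)).entropy (sliceAverage (ρ n)) /
        Fintype.card (V n × W n) := by
    rw [hcard]
    field_simp
  rw [h2, ← add_div]
  exact div_le_div_of_nonneg_right (by linarith) (Nat.cast_nonneg _)

end Comparison

end SoficEntropy

end

theorem mainTheorem7
    {G : Type*} [Group G] [Countable G]
    {V : ℕ → Type*} [∀ n, Fintype (V n)] [∀ n, Nonempty (V n)]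
    (σ : ∀ n, G → Equiv.Perm (V n)) (hσ : SoficEntropy.IsSoficApproximation σ)
    (W : ℕ → Type*) [∀ n, Fintype (W n)] [∀ n, Nonempty (W n)]
    (hW : Tendsto (fun n => Fintype.card (W n)) atTop atTop)
    {X : Type*} [MetricSpace X] [CompactSpace X] [MeasurableSpace X] [BorelSpace X]
    (μ : ProbabilityMeasure (G → X))
    (𝔓 : Set (SoficEntropy.FinitePartition X)) (h𝔓 : SoficEntropy.IsCompatibleFamily 𝔓 μ) :
    SoficEntropy.modelMeasureEntropy (SoficEntropy.enlarge σ W) μ =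
      SoficEntropy.localShannonEntropy σ μ 𝔓 := by
  open SoficEntropy in
  refine le_antisymm ?_ ?_
  · refine iSup_le fun n => iSup_le fun hn => iSup_le fun ν => iSup_le fun hν => iSup_le fun ε =>
      iSup_le fun hε => iSup_le fun δ => iSup_le fun hδ => ?_
    obtain ⟨P, hP𝔓, hP⟩ := h𝔓.mesh δ hδ
    -- The conditioning step needs `ε ≤ 1`; decreasing `ε` only increases the covering number.
    have hε' : 0 < min ε 1 := lt_min hε one_pos
    obtain ⟨ν', hν', hle⟩ := LDEConverges.exists_lwConverges_entropy_ge
      (σ := fun i => σ (n i)) (W := fun i => W (n i)) hν hP hε' (min_le_right _ _)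
    have hup : limsup (fun i => (((P.power (V (n i))).entropy (ν' i) / Fintype.card (V (n i)) : ℝ) :
        EReal)) atTop ≤ localShannonEntropy σ μ 𝔓 :=
      le_iSup_of_le P <| le_iSup_of_le hP𝔓 <| le_iSup_of_le n <| le_iSup_of_le hn <|
        le_iSup_of_le ν' <| le_iSup_of_le hν' le_rfl
    refine limsup_le_of_eventually_le_add fun η hη => ⟨_, ?_, hup⟩
    -- The loss `-log ε` from conditioning is constant, so it vanishes after normalisation.
    have hcard : Tendsto (fun i => (Fintype.card (V (n i) × W (n i)) : ℝ)) atTop atTop := by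
      refine tendsto_natCast_atTop_atTop.comp
        (tendsto_atTop_mono (fun i => ?_) (hW.comp hn.tendsto_atTop))
      rw [Fintype.card_prod]
      exact Nat.le_mul_of_pos_left _ Fintype.card_pos
    have hlim := (tendsto_const_nhds (x := -Real.log (min ε 1))).div_atTop hcard
    filter_upwards [hlim.eventually (gt_mem_nhds hη)] with i hi
    have hpos : (0 : EReal) ≤ (Fintype.card (V (n i) × W (n i)) : EReal) := by
      exact_mod_cast Nat.zero_le _
    refine (EReal.div_le_div_right_of_nonneg hpos (ENNReal.log_monotone (ENat.toENNReal_mono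
      (coveringNumber_anti (min_le_left ε 1))))).trans ((hle i).trans (add_le_add le_rfl ?_))
    exact EReal.coe_le_coe_iff.2 hi.le
  · refine iSup_le fun P => iSup_le fun hP => iSup_le fun n => iSup_le fun hn => iSup_le fun ν =>
      iSup_le fun hν => ?_
    have hlde := LWConverges.ldeConverges_iidPower (W := fun i => W (n i))
      (hW.comp hn.tendsto_atTop) hν
    refine limsup_le_of_eventually_le_add fun η hη => ?_
    obtain ⟨ε, δ, hε, hδ, hle⟩ := LWConverges.exists_entropy_le_log_coveringNumber
      (W := fun i => W (n i)) hν P (h𝔓.continuity P hP) hη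
    refine ⟨_, hle, ?_⟩
    exact le_iSup_of_le n <| le_iSup_of_le hn <| le_iSup_of_le
      (fun i => iidPower (W (n i)) (ν i)) <| le_iSup_of_le hlde <| le_iSup_of_le ε <|
      le_iSup_of_le hε <| le_iSup_of_le δ <| le_iSup_of_le hδ le_rfl
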